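/- Let $\Sigma$ be a finite alphabet and let $R$ be a reflexive and symmetric relation on $\Sigma$. Let $\mathcal M_\Sigma=\langle \Sigma\mid ab=ba \text{ for } (a,b)\notin R\rangle$ be the associated trace monoid, with length $|\cdot|$, and assume that it is irreducible, that is, that the graph $(\Sigma,R)$ is connected. Let $a_1\in\Sigma$. Notation. For $S\subseteq\Sigma$, $\mathcal M_S$ is the submonoid generated by $S$, and $\mu_S(X)=\sum_\gamma(-X)^{|\gamma|}$, where $\gamma$ ranges over the subsets of $S$ with $(a,b)\notin R$ for all distinct $a,b\in\gamma$, is its Möbius polynomial. For $S\ne\emptyset$, $p_S$ is the root of smallest modulus of $\mu_S$ in $\mathbb C$ (it is real and positive), and $p_\emptyset=\infty$. $B_{S,p}$ gives the mass $\mu_S(p)p^{|x|}$ to each $x\in\mathcal M_S$. Each trace $x$ is represented by its heap, a labelled poset: its elements are the positions of a word representing $x$, labelled by their letters, and its order is generated by the pairs $i\le j$ of positions whose labels are $R$-related. One writes $\max(x)\subseteq U$ if all maximal elements of the heap of $x$ have their label in $U$, and $\mathrm{Lk}(a_1)=\{b\in\Sigma : (a_1,b)\in R\}$. If $a_1$ occurs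 in $x$, $V_{a_1}(x)$ is the trace whose heap consists of the elements of the heap of $x$ that lie below (or are equal to) the first element labelled $a_1$; the traces $V_{a_1}(x)$ are called $a_1$-pyramidal and form the set $\mathrm{Pyr}_{a_1}$. With $\le$ the left divisibility order, the boundary $\partial\mathcal M_\Sigma$ is the set of infinite traces: classes of non-decreasing sequences $(x_n)$ in $\mathcal M_\Sigma$ under mutual domination ($(x_n)$ is dominated by $(y_n)$ if every $x_n$ is $\le$ some $y_k$), excluding the classes of constant sequences. It carries the $\sigma$-algebra generated by the visual cylinders $\uparrow x=\{\xi : x\le \xi\}$, $x\in\mathcal M_\Sigma$. The uniform measure at infinity is the probability measure $\mathbf B$ on $\partial\mathcal M_\Sigma$ with $\mathbf B(\uparrow x)=p_\Sigma^{|x|}$ for all $x\in\mathcal M_\Sigma$. For an infinite trace $\xi$, the class of $(x_n)$, in which $a_1$ occurs, $V_{a_1}(\xi)$ is the eventual value of $V_{a_1}(x_n)$. Claim. 1. $0<p_\Sigma<p_{\Sigma\setminus\{a_1\}}$. The distribution $B_{\Sigma\setminus\{a_1\},p_\Sigma}$ is a well-defined probability distribution on $\mathcal M_{\Sigma\setminus\{a_1\}}$,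 and it gives positive probability to $\{z : \max(z)\subseteq\mathrm{Lk}(a_1)\}$. 2. The uniform measure at infinity $\mathbf B$ exists and is unique. The map $V_{a_1}$ is well defined $\mathbf B$-almost surely, and $\mathbf B(V_{a_1}=v)=p_\Sigma^{|v|}$ for all $v\in\mathrm{Pyr}_{a_1}$. 3. Let $Z$ be a random element of $\mathcal M_{\Sigma\setminus\{a_1\}}$ distributed according to $B_{\Sigma\setminus\{a_1\},p_\Sigma}$ conditionally on $\{\max(z)\subseteq\mathrm{Lk}(a_1)\}$. Then, with probability $1$, $Z\cdot a_1\in\mathrm{Pyr}_{a_1}$; one has $\mathbb P(Z\cdot a_1=v)=p_\Sigma^{|v|}$ for all $v\in\mathrm{Pyr}_{a_1}$; and $Z\cdot a_1$ has the same law as $V_{a_1}$ under $\mathbf B$. -/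

import Mathlib

open MeasureTheory ProbabilityTheory
open scoped ENNReal

noncomputable section

universe u

/-- The commutation relations `ab = ba` for `(a, b) ∉ R`. -/
inductive TraceRel {α : Type u} (R : α → α → Prop) : FreeMonoid α → FreeMonoid α → Prop
  | comm (a b : α) (h : ¬ R a b) :
      TraceRel R (FreeMonoid.of a * FreeMonoid.of b) (FreeMonoid.of b * FreeMonoid.of a)

/-- The trace monoid `⟨α | ab = ba for (a, b) ∉ R⟩`. -/
def TraceMonoid {α : Type u} (R : α → α → Prop) : Type u :=
  PresentedMonoid (TraceRel R)

namespace TraceMonoid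

variable {α : Type u} {R : α → α → Prop}

instance : Monoid (TraceMonoid R) :=
  inferInstanceAs (Monoid (PresentedMonoid (TraceRel R)))

/-- Traces form a discrete space: every set of traces is an event. -/
instance : MeasurableSpace (TraceMonoid R) := ⊤

/-- The trace of a word. -/
def word (R : α → α → Prop) (w : List α) : TraceMonoid R :=
  PresentedMonoid.mk (TraceRel R) (FreeMonoid.ofList w)

/-- The generator of the trace monoid given by a letter. -/
def letter (R : α → α → Prop) (a : α) : TraceMonoid R :=
  PresentedMonoid.of (TraceRel R) a

/-- The additive weight of traces induced by a weight on letters. -/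
def weight (R : α → α → Prop) (f : α → ℕ) : TraceMonoid R →* Multiplicative ℕ :=
  PresentedMonoid.lift (rels := TraceRel R) (fun b => Multiplicative.ofAdd (f b)) (by
    rintro _ _ ⟨a, b, _⟩
    simp [mul_comm])

/-- The length `|x|` of a trace. -/
def len (x : TraceMonoid R) : ℕ := Multiplicative.toAdd (weight R (fun _ => 1) x)

open Classical in
/-- The number `|x|_a` of occurrences of the letter `a` in the trace `x`. -/
def count (a : α) (x : TraceMonoid R) : ℕ :=
  Multiplicative.toAdd (weight R (fun b => if b = a then 1 else 0) x)

/-- The submonoid `M_S` generated by the letters of `S`. -/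
def sub (R : α → α → Prop) (S : Set α) : Submonoid (TraceMonoid R) :=
  Submonoid.closure (letter R '' S)

/-! ### Heaps -/

/-- The order of the heap represented by a word `w`: its pieces are the positions of `w`, the label
of a position is the letter found there, and the order is generated by the pairs `i ≤ j` of
positions with related labels. Two words with the same trace give isomorphic heaps. -/
def HeapLE (R : α → α → Prop) (w : List α) : Fin w.length → Fin w.length → Prop :=
  Relation.ReflTransGen fun i j => i ≤ j ∧ R (w.get i) (w.get j)

/-- `max(x) ⊆ U`: all maximal pieces of the heap of `x` have their label in `U`. -/
def MaxIn (U : Set α) (x : TraceMonoid R) : Prop :=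
  ∀ w : List α, word R w = x →
    ∀ i : Fin w.length, (∀ j, HeapLE R w i j → j = i) → w.get i ∈ U

/-- The link of a letter. -/
def link (R : α → α → Prop) (a : α) : Set α := {b | R a b}

open Classical in
/-- The word read on the pieces of the heap of `w` that lie below the piece `i`. -/
def belowWord (R : α → α → Prop) (w : List α) (i : Fin w.length) : List α :=
  ((List.finRange w.length).filter fun j => HeapLE R w j i).map w.get

/-- `V_a(x) = y`: in the heap of `x`, the pieces labelled `a` have a minimum, and the sub-heap
of the pieces below it is the heap of `y`. -/
def IsV (a : α) (x y : TraceMonoid R) : Prop :=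
  ∃ w : List α, word R w = x ∧ ∃ i : Fin w.length,
    w.get i = a ∧ (∀ j, w.get j = a → HeapLE R w i j) ∧ y = word R (belowWord R w i)

/-- The set of `a`-pyramidal traces. -/
def Pyr (R : α → α → Prop) (a : α) : Set (TraceMonoid R) :=
  {y | ∃ x : TraceMonoid R, 0 < count a x ∧ IsV a x y}

/-! ### Möbius polynomials and multiplicative probabilities -/

open Classical in
/-- The Möbius polynomial `μ_S(X) = ∑_γ (-X)^|γ|`, where `γ` ranges over the sets of pairwise
commuting distinct letters of `S`. -/
def mobius (R : α → α → Prop) (S : Finset α) : Polynomial ℝ :=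
  ∑ γ ∈ S.powerset.filter (fun γ : Finset α => (γ : Set α).Pairwise fun a b => ¬ R a b),
    (-Polynomial.X) ^ γ.card

/-- `p_S`, the smallest modulus of a complex root of `μ_S`; it is `∞` if `μ_S` has no root,
that is, for `S = ∅`. -/
def pRoot (R : α → α → Prop) (S : Finset α) : ℝ≥0∞ :=
  ⨅ (z : ℂ) (_ : Polynomial.aeval z (mobius R S) = 0), ‖z‖ₑ

/-- The distribution `B_{S,p}` on `M_S`, which gives the mass `μ_S(p) p^|x|` to each `x`. -/
def multMeasure (R : α → α → Prop) (S : Finset α) (p : ℝ) : Measure (sub R (S : Set α)) :=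
  Measure.sum fun x : sub R (S : Set α) =>
    ENNReal.ofReal ((mobius R S).eval p * p ^ len (x : TraceMonoid R)) • Measure.dirac x

/-! ### Infinite traces -/

/-- Sequences of traces that are non-decreasing for left divisibility. -/
structure NDSeq (R : α → α → Prop) where
  seq : ℕ → TraceMonoid R
  mono : ∀ n, seq n ∣ seq (n + 1)

/-- The preorder on non-decreasing sequences. -/
instance : Preorder (NDSeq R) where
  le s t := ∀ n, ∃ k, s.seq n ∣ t.seq k
  le_refl _ n := ⟨n, dvd_rfl⟩
  le_trans _ _ _ h₁ h₂ n :=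
    let ⟨k, hk⟩ := h₁ n
    let ⟨m, hm⟩ := h₂ k
    ⟨m, hk.trans hm⟩

/-- Generalized traces: classes of non-decreasing sequences, with the induced partial order. -/
abbrev GenTrace (R : α → α → Prop) : Type u :=
  Antisymmetrization (NDSeq R) (· ≤ ·)

/-- The class of a non-decreasing sequence, which is its least upper bound. -/
def GenTrace.lim (s : NDSeq R) : GenTrace R := toAntisymmetrization (· ≤ ·) s

/-- A trace seen as a generalized trace, through the constant sequence. -/
def GenTrace.ofTrace (x : TraceMonoid R) : GenTrace R := GenTrace.lim ⟨fun _ => x, fun _ => dvd_rfl⟩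

/-- The boundary: generalized traces that are not traces. -/
def Boundary (R : α → α → Prop) : Type u :=
  {ξ : GenTrace R // ξ ∉ Set.range (GenTrace.ofTrace (R := R))}

/-- The visual cylinder of base `x`. -/
def cylinder (x : TraceMonoid R) : Set (Boundary R) := {ξ | GenTrace.ofTrace x ≤ ξ.1}

/-- The σ-algebra of the boundary, generated by the (countably many) visual cylinders. -/
instance : MeasurableSpace (Boundary R) :=
  MeasurableSpace.generateFrom (Set.range (cylinder (R := R)))

/-- `m` is a uniform measure at infinity: a probability measure on the boundary with
`m(↑x) = p_Σ^|x|` for every trace `x`. -/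
structure IsUniformMeasure [Fintype α] (m : Measure (Boundary R)) : Prop where
  prob : IsProbabilityMeasure m
  apply_cylinder : ∀ x : TraceMonoid R, m (cylinder x) = pRoot R Finset.univ ^ len x

/-- `V_a(ξ) = v` for an infinite trace `ξ`: along a non-decreasing sequence with least upper
bound `ξ`, the traces `V_a(x_n)` are eventually defined and equal to `v`. -/
def IsVInf (a : α) (ξ : Boundary R) (v : TraceMonoid R) : Prop :=
  ∃ s : NDSeq R, GenTrace.lim s = ξ.1 ∧ ∃ q, ∀ n ≥ q, IsV a (s.seq n) v

open Classical in
/-- The map `V_a` on the boundary, with the value `1` (which is not pyramidal) where it is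
not defined. -/
def VInf (a : α) (ξ : Boundary R) : TraceMonoid R :=
  if h : ∃ v, IsVInf a ξ v then h.choose else 1

end TraceMonoid

end


/-!
An `a`-pyramidal trace is a product `z * a` in which `a` does not occur in `z` and the maximal
letters of `z` are linked to `a`; every trace containing `a` is uniquely a pyramid times another
trace. Möbius inversion turns this into
`μ_{Σ∖{a}}(t) * ∑ v ∈ Pyr a, t ^ |v| = μ_{Σ∖{a}}(t) - μ_Σ(t)`, so the weights `p_Σ ^ |v|` of the
pyramids sum to `1` at the root `p_Σ` of `μ_Σ`. That `p_Σ` is smaller than the root of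
`μ_{Σ∖{a}}` comes from irreducibility, through a pyramid in which every letter occurs.

The uniform measure is the law of the infinite product of independent pyramids drawn with these
weights. If `a` does not occur in `z`, the cylinders `↑(z * v)` for `v ∈ Pyr a` partition `↑z` up to
a null set, and each of their masses is `p_Σ ^ |v|` times that of `↑z` or, by induction on `|z|`,
`p_Σ ^ (|z| + |v|)`; the latter happens for at least one `v`, which forces the mass of `↑z` to be
`p_Σ ^ |z|`.
-/

noncomputable section

namespace TraceMonoid

variable {α : Type u} {R : α → α → Prop}

/-! ### Words, lengths and letters -/

@[simp]
theorem word_nil : word R [] = 1 := rfl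

theorem word_cons (a : α) (w : List α) : word R (a :: w) = letter R a * word R w := rfl

theorem word_singleton (a : α) : word R [a] = letter R a := rfl

theorem word_surjective : Function.Surjective (word R) :=
  PresentedMonoid.surjective_mk

theorem commute_letter_letter {a b : α} (h : ¬ R a b) : Commute (letter R a) (letter R b) :=
  PresentedMonoid.mk_eq_mk_of_rel (TraceRel.comm a b h)

@[elab_as_elim]
theorem induction_left {motive : TraceMonoid R → Prop} (x : TraceMonoid R) (one : motive 1)
    (letter_mul : ∀ a x, motive x → motive (letter R a * x)) : motive x := by
  obtain ⟨w, rfl⟩ := word_surjective x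
  induction w with
  | nil => exact one
  | cons a w ih => exact letter_mul a _ ih

@[elab_as_elim]
theorem induction_right {motive : TraceMonoid R → Prop} (x : TraceMonoid R) (one : motive 1)
    (mul_letter : ∀ x a, motive x → motive (x * letter R a)) : motive x := by
  obtain ⟨w, rfl⟩ := word_surjective x
  induction w using List.reverseRecOn with
  | nil => exact one
  | append_singleton w a ih => exact mul_letter _ a ih

theorem weight_letter (f : α → ℕ) (a : α) :
    weight R f (letter R a) = Multiplicative.ofAdd (f a) := rfl

@[simp]
theorem len_one : len (1 : TraceMonoid R) = 0 := by simp [len]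

@[simp]
theorem len_mul (x y : TraceMonoid R) : len (x * y) = len x + len y := by simp [len]

@[simp]
theorem len_letter (a : α) : len (letter R a) = 1 := rfl

@[simp]
theorem len_word (w : List α) : len (word R w) = w.length := by
  induction w with
  | nil => simp
  | cons a w ih => simp [word_cons, ih, add_comm]

@[simp]
theorem len_eq_zero {x : TraceMonoid R} : len x = 0 ↔ x = 1 := by
  refine ⟨fun h => ?_, fun h => by simp [h]⟩
  obtain ⟨w, rfl⟩ := word_surjective x
  rw [len_word, List.length_eq_zero_iff] at h
  rw [h, word_nil]

@[simp]
theorem count_one (a : α) : count a (1 : TraceMonoid R) = 0 := by simp [count]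

@[simp]
theorem count_mul (a : α) (x y : TraceMonoid R) : count a (x * y) = count a x + count a y := by
  simp [count]

@[simp]
theorem count_letter_self (a : α) : count a (letter R a) = 1 := by simp [count, weight_letter]

theorem count_letter_of_ne {a b : α} (h : b ≠ a) : count a (letter R b) = 0 := by
  simp [count, weight_letter, h]

@[simp]
theorem count_letter_pos {a b : α} : 0 < count a (letter R b) ↔ b = a := by
  by_cases h : b = a <;> simp [count, weight_letter, h]

@[simp]
theorem count_word_pos {a : α} {w : List α} : 0 < count a (word R w) ↔ a ∈ w := by
  induction w with
  | nil => simp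
  | cons b w ih => simp only [word_cons, count_mul, Nat.add_pos_iff_pos_or_pos, count_letter_pos,
      ih, List.mem_cons, eq_comm]

theorem mem_sub_iff {S : Set α} {x : TraceMonoid R} :
    x ∈ sub R S ↔ ∀ b, 0 < count b x → b ∈ S := by
  constructor
  · intro hx
    induction hx using Submonoid.closure_induction with
    | mem y hy =>
      obtain ⟨c, hc, rfl⟩ := hy
      rintro b hb
      rwa [← count_letter_pos.1 hb]
    | one => simp
    | mul y z _ _ hy hz =>
      intro b hb
      rw [count_mul, Nat.add_pos_iff_pos_or_pos] at hb
      exact hb.elim (hy b) (hz b)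
  · induction x using induction_left with
    | one => exact fun _ => Submonoid.one_mem _
    | letter_mul a x ih =>
      intro h
      exact Submonoid.mul_mem _ (Submonoid.subset_closure ⟨a, h a (by simp), rfl⟩)
        (ih fun b hb => h b (by simp [hb]))

@[simp]
theorem mul_mem_sub_iff {S : Set α} {x y : TraceMonoid R} :
    x * y ∈ sub R S ↔ x ∈ sub R S ∧ y ∈ sub R S := by
  simp only [mem_sub_iff, count_mul, Nat.add_pos_iff_pos_or_pos, or_imp, forall_and]

@[simp]
theorem letter_mem_sub_iff {S : Set α} {b : α} : letter R b ∈ sub R S ↔ b ∈ S := by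
  simp [mem_sub_iff]

theorem word_mem_sub_iff {S : Set α} {w : List α} : word R w ∈ sub R S ↔ ∀ b ∈ w, b ∈ S := by
  simp [mem_sub_iff]

/-! ### Cancellation -/

open Classical in
/-- The action of a letter `b` on pairs made of a trace and of the result of erasing its first
letter `a`. -/
def eraseStep (R : α → α → Prop) (a b : α) : Function.End (TraceMonoid R × TraceMonoid R) :=
  fun p => (letter R b * p.1, if b = a then p.1 else letter R b * p.2)

theorem eraseStep_comm (a : α) {b c : α} (h : ¬ R b c) :
    eraseStep R a b * eraseStep R a c = eraseStep R a c * eraseStep R a b := by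
  have letter_comm := (commute_letter_letter h).left_comm
  funext ⟨x, y⟩
  change eraseStep R a b (eraseStep R a c (x, y)) = eraseStep R a c (eraseStep R a b (x, y))
  simp only [eraseStep, letter_comm]
  grind

/-- The action of the trace monoid given by `eraseStep`. -/
def eraseHom (R : α → α → Prop) (a : α) :
    TraceMonoid R →* Function.End (TraceMonoid R × TraceMonoid R) :=
  PresentedMonoid.lift (rels := TraceRel R) (eraseStep R a) (by
    rintro _ _ ⟨b, c, h⟩
    simpa using eraseStep_comm a h)

theorem eraseHom_letter_mul (a b : α) (x : TraceMonoid R) (p : TraceMonoid R × TraceMonoid R) :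
    eraseHom R a (letter R b * x) p = eraseStep R a b (eraseHom R a x p) := by
  rw [map_mul]
  rfl

theorem eraseHom_fst (a : α) (x : TraceMonoid R) : (eraseHom R a x 1).1 = x := by
  induction x using induction_left with
  | one => rw [map_one]; rfl
  | letter_mul b x ih => rw [eraseHom_letter_mul, eraseStep, ih]

/-- The trace `x` with its first letter `a` erased, if there is one. -/
def eraseFirst (a : α) (x : TraceMonoid R) : TraceMonoid R := (eraseHom R a x 1).2

theorem eraseFirst_letter_mul_self (a : α) (x : TraceMonoid R) :
    eraseFirst a (letter R a * x) = x := by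
  rw [eraseFirst, eraseHom_letter_mul, eraseStep, eraseHom_fst]
  exact if_pos rfl

theorem eraseFirst_letter_mul_of_ne {a b : α} (h : b ≠ a) (x : TraceMonoid R) :
    eraseFirst a (letter R b * x) = letter R b * eraseFirst a x := by
  rw [eraseFirst, eraseHom_letter_mul, eraseStep]
  exact if_neg h

/-- The reversal of traces, as a morphism to the opposite monoid. -/
def revHom (R : α → α → Prop) : TraceMonoid R →* (TraceMonoid R)ᵐᵒᵖ :=
  PresentedMonoid.lift (rels := TraceRel R) (fun b => MulOpposite.op (letter R b)) (by
    rintro _ _ ⟨a, b, h⟩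
    simp [← MulOpposite.op_mul, (commute_letter_letter h).eq])

/-- The reversal of a trace, which exchanges left and right divisibility. -/
def rev (x : TraceMonoid R) : TraceMonoid R := (revHom R x).unop

@[simp]
theorem rev_one : rev (1 : TraceMonoid R) = 1 := by simp [rev]

@[simp]
theorem rev_mul (x y : TraceMonoid R) : rev (x * y) = rev y * rev x := by simp [rev]

@[simp]
theorem rev_letter (a : α) : rev (letter R a) = letter R a := rfl

@[simp]
theorem rev_rev (x : TraceMonoid R) : rev (rev x) = x := by
  induction x using induction_left with
  | one => simp
  | letter_mul a x ih => simp [ih]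

@[simp]
theorem count_rev (a : α) (x : TraceMonoid R) : count a (rev x) = count a x := by
  induction x using induction_left with
  | one => simp
  | letter_mul b x ih => simp [ih, add_comm]

instance : IsLeftCancelMul (TraceMonoid R) where
  mul_left_cancel z x y h := by
    induction z using induction_left with
    | one => simpa using h
    | letter_mul a z ih =>
      refine ih ?_
      simpa only [mul_assoc, eraseFirst_letter_mul_self] using congrArg (eraseFirst a) h

instance : IsCancelMul (TraceMonoid R) where
  mul_right_cancel z x y h := by
    have hrev : rev z * rev x = rev z * rev y := by simpa using congrArg rev h
    simpa using congrArg rev (mul_left_cancel hrev)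

theorem dvd_letter_mul_letter_mul_iff {a : α} {x y : TraceMonoid R} :
    letter R a * x ∣ letter R a * y ↔ x ∣ y := by
  simp only [dvd_def, mul_assoc, mul_right_inj]

/-! ### Divisibility by a letter -/

open Classical in
/-- The projection to the free monoid that keeps the letters `a` and `b` only, for two related
letters `a` and `b`. -/
def pairHom [Std.Symm R] {a b : α} (h : R a b) : TraceMonoid R →* FreeMonoid α :=
  PresentedMonoid.lift (rels := TraceRel R)
    (fun c => if c = a ∨ c = b then FreeMonoid.of c else 1) (by
      rintro _ _ ⟨c, d, hcd⟩
      have hba := symm_of R h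
      simp only [FreeMonoid.lift_eval_of, map_mul]
      grind)

theorem pairHom_letter [Std.Symm R] {a b c : α} (h : R a b) (hc : c = a ∨ c = b) :
    pairHom h (letter R c) = FreeMonoid.of c :=
  (PresentedMonoid.lift_of ..).trans (if_pos hc)

theorem letter_mul_ne_letter_mul [Std.Symm R] {a b : α} (h : R a b) (hab : a ≠ b)
    (x y : TraceMonoid R) : letter R a * x ≠ letter R b * y := by
  intro heq
  have hword := congrArg (FreeMonoid.toList ∘ pairHom h) heq
  simp only [Function.comp_apply, map_mul, pairHom_letter h (.inl rfl),
    pairHom_letter h (.inr rfl), FreeMonoid.toList_of_mul, List.cons.injEq] at hword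
  exact hab hword.1

theorem letter_dvd_letter_mul [Std.Symm R] {a b : α} (hab : a ≠ b) {x : TraceMonoid R}
    (h : letter R a ∣ letter R b * x) : ¬ R a b ∧ letter R a ∣ x := by
  obtain ⟨y, hy⟩ := h
  refine ⟨fun hR => letter_mul_ne_letter_mul hR hab y x hy.symm, eraseFirst b y, ?_⟩
  simpa only [eraseFirst_letter_mul_self, eraseFirst_letter_mul_of_ne hab] using
    congrArg (eraseFirst b) hy

/-- The letter `a` is related to no letter of the trace `y`: it commutes with each of them and,
when `R` is reflexive, does not occur in `y`. -/
def Unrelated (a : α) (y : TraceMonoid R) : Prop := ∀ b, 0 < count b y → ¬ R a b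

@[simp]
theorem unrelated_one (a : α) : Unrelated a (1 : TraceMonoid R) := by simp [Unrelated]

@[simp]
theorem unrelated_mul {a : α} {x y : TraceMonoid R} :
    Unrelated a (x * y) ↔ Unrelated a x ∧ Unrelated a y := by
  simp only [Unrelated, count_mul, Nat.add_pos_iff_pos_or_pos, or_imp, forall_and]

@[simp]
theorem unrelated_letter {a b : α} : Unrelated a (letter R b) ↔ ¬ R a b := by
  simp [Unrelated]

theorem unrelated_word {a : α} {w : List α} : Unrelated a (word R w) ↔ ∀ b ∈ w, ¬ R a b := by
  simp [Unrelated]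

@[simp]
theorem unrelated_rev {a : α} {x : TraceMonoid R} : Unrelated a (rev x) ↔ Unrelated a x := by
  simp [Unrelated]

theorem Unrelated.commute {a : α} {y : TraceMonoid R} (h : Unrelated a y) :
    Commute (letter R a) y := by
  induction y using induction_left with
  | one => exact .one_right _
  | letter_mul b y ih =>
    rw [unrelated_mul, unrelated_letter] at h
    exact .mul_right (commute_letter_letter h.1) (ih h.2)

theorem letter_dvd_mul [Std.Symm R] {a : α} {x y : TraceMonoid R} (h : letter R a ∣ x * y) :
    letter R a ∣ x ∨ (Unrelated a x ∧ letter R a ∣ y) := by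
  induction x using induction_left with
  | one => exact .inr ⟨unrelated_one a, by simpa using h⟩
  | letter_mul b x ih =>
    by_cases hab : a = b
    · exact .inl (hab ▸ dvd_mul_right _ _)
    · rw [mul_assoc] at h
      obtain ⟨hR, hdvd⟩ := letter_dvd_letter_mul hab h
      refine (ih hdvd).imp (fun hax => ?_) fun ⟨hx, hay⟩ => ⟨by simp [hR, hx], hay⟩
      obtain ⟨z, rfl⟩ := hax
      exact ⟨letter R b * z, (commute_letter_letter hR).symm.left_comm z⟩

theorem Unrelated.dvd_letter_mul_iff [Std.Symm R] {a : α} {y : TraceMonoid R}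
    (hy : Unrelated a y) (hay : ¬ letter R a ∣ y) {m : TraceMonoid R} :
    y ∣ letter R a * m ↔ y ∣ m := by
  refine ⟨fun ⟨n, hn⟩ => ?_, fun ⟨n, hn⟩ => ⟨letter R a * n, ?_⟩⟩
  · obtain ⟨-, n, rfl⟩ := (letter_dvd_mul (Dvd.intro m hn)).resolve_left hay
    rw [← hy.commute.left_comm] at hn
    exact ⟨n, mul_left_cancel hn⟩
  · rw [hn, hy.commute.left_comm]

theorem exists_dvd_letter_mul_iff [Std.Symm R] (a : α) (y : TraceMonoid R) :
    (∃ r, ∀ m, y ∣ letter R a * m ↔ r ∣ m) ∨ ∀ m, ¬ y ∣ letter R a * m := by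
  by_cases hay : letter R a ∣ y
  · obtain ⟨r, rfl⟩ := hay
    exact .inl ⟨r, fun m => dvd_letter_mul_letter_mul_iff⟩
  · by_cases hy : Unrelated a y
    · exact .inl ⟨y, fun m => hy.dvd_letter_mul_iff hay⟩
    · exact .inr fun m ⟨n, hn⟩ => hy ((letter_dvd_mul (Dvd.intro m hn)).resolve_left hay).1

/-- The alternative says whether `x` and `y` have a common multiple; if they do, `x * r` is their
least common multiple. -/
theorem exists_dvd_mul_iff [Std.Symm R] (x y : TraceMonoid R) :
    (∃ r, ∀ m, y ∣ x * m ↔ r ∣ m) ∨ ∀ m, ¬ y ∣ x * m := by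
  induction x using induction_left generalizing y with
  | one => exact .inl ⟨y, fun m => by rw [one_mul]⟩
  | letter_mul a x ih =>
    simp only [mul_assoc]
    obtain ⟨r, hr⟩ | hr := exists_dvd_letter_mul_iff a y
    · simpa only [hr] using ih r
    · exact .inr fun m => hr _

/-! ### Last letters -/

/-- The letter `c` divides the trace `x` on the right, that is, the heap of `x` has a maximal
element labelled `c`. -/
def EndsWith (c : α) (x : TraceMonoid R) : Prop := ∃ y, x = y * letter R c

theorem endsWith_iff_letter_dvd_rev {c : α} {x : TraceMonoid R} :
    EndsWith c x ↔ letter R c ∣ rev x := by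
  constructor
  · rintro ⟨y, rfl⟩
    exact ⟨rev y, by simp⟩
  · rintro ⟨y, hy⟩
    exact ⟨rev y, by simpa using congrArg rev hy⟩

theorem endsWith_mul_letter (c : α) (x : TraceMonoid R) : EndsWith c (x * letter R c) := ⟨x, rfl⟩

theorem EndsWith.mul_left {c : α} {x : TraceMonoid R} (h : EndsWith c x) (y : TraceMonoid R) :
    EndsWith c (y * x) := by
  obtain ⟨z, rfl⟩ := h
  exact ⟨y * z, (mul_assoc _ _ _).symm⟩

theorem EndsWith.mul_of_unrelated {c : α} {x y : TraceMonoid R} (h : EndsWith c x)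
    (hy : Unrelated c y) : EndsWith c (x * y) := by
  obtain ⟨z, rfl⟩ := h
  exact ⟨z * y, by rw [mul_assoc, hy.commute.eq, mul_assoc]⟩

theorem EndsWith.of_mul [Std.Symm R] {c : α} {x y : TraceMonoid R} (h : EndsWith c (x * y)) :
    EndsWith c y ∨ (Unrelated c y ∧ EndsWith c x) := by
  rw [endsWith_iff_letter_dvd_rev, rev_mul] at h
  simpa only [endsWith_iff_letter_dvd_rev, unrelated_rev] using letter_dvd_mul h

theorem EndsWith.count_pos {c : α} {x : TraceMonoid R} (h : EndsWith c x) : 0 < count c x := by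
  obtain ⟨z, rfl⟩ := h
  simp

theorem endsWith_letter {b c : α} : EndsWith c (letter R b) ↔ b = c :=
  ⟨fun h => count_letter_pos.1 h.count_pos, fun h => ⟨1, by rw [h, one_mul]⟩⟩

theorem exists_endsWith {x : TraceMonoid R} (h : x ≠ 1) : ∃ c, EndsWith c x := by
  induction x using induction_right with
  | one => exact absurd rfl h
  | mul_letter x a _ => exact ⟨a, x, rfl⟩

/-! ### Pyramidal traces -/

/-- The trace `v` has exactly one occurrence of `a`, and `a` is its unique last letter: this is the
algebraic form of pyramidality, equivalent to `v ∈ Pyr R a` by `mem_pyr_iff`. -/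
structure IsPyramid (a : α) (v : TraceMonoid R) : Prop where
  endsWith : EndsWith a v
  count_eq_one : count a v = 1
  eq_of_endsWith {c : α} : EndsWith c v → c = a

theorem isPyramid_letter (a : α) : IsPyramid a (letter R a) :=
  ⟨endsWith_letter.2 rfl, count_letter_self a, fun h => (endsWith_letter.1 h).symm⟩

theorem IsPyramid.len_pos {a : α} {v : TraceMonoid R} (h : IsPyramid a v) : 0 < len v := by
  obtain ⟨z, rfl⟩ := h.endsWith
  simp

theorem IsPyramid.eq_one_of_eq_mul {a : α} {v v' s : TraceMonoid R} (hv : IsPyramid a v)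
    (hv' : IsPyramid a v') (h : v = v' * s) : s = 1 := by
  by_contra hs
  obtain ⟨c, hc⟩ := exists_endsWith hs
  have hca : c = a := hv.eq_of_endsWith (h ▸ hc.mul_left v')
  have hcount := hv.count_eq_one
  rw [h, count_mul, hv'.count_eq_one] at hcount
  have := hca ▸ hc.count_pos
  omega

section Symm

variable [Std.Symm R]

theorem IsPyramid.letter_mul {a b : α} (hb : b ≠ a) {v : TraceMonoid R} (hv : IsPyramid a v)
    (h : ¬ Unrelated b v) : IsPyramid a (letter R b * v) where
  endsWith := hv.endsWith.mul_left _
  count_eq_one := by rw [count_mul, count_letter_of_ne hb, hv.count_eq_one]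
  eq_of_endsWith hc := by
    obtain hcv | ⟨hcv, hcb⟩ := hc.of_mul
    · exact hv.eq_of_endsWith hcv
    · exact absurd (endsWith_letter.1 hcb ▸ hcv) h

theorem IsPyramid.eq_of_mul_eq_mul [Std.Refl R] {a : α} {v v' r s : TraceMonoid R}
    (hv : IsPyramid a v) (hv' : IsPyramid a v') (h : v * r = v' * s) : v = v' := by
  induction r using induction_right generalizing s with
  | one =>
    rw [mul_one] at h
    rw [h, hv.eq_one_of_eq_mul hv' h, mul_one]
  | mul_letter r c ih =>
    rw [← mul_assoc] at h
    have hc : EndsWith c (v' * s) := ⟨_, h.symm⟩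
    obtain ⟨s', rfl⟩ | ⟨hcs, hcv'⟩ := hc.of_mul
    · rw [← mul_assoc] at h
      exact ih (mul_right_cancel h)
    · obtain rfl := hv'.eq_of_endsWith hcv'
      have hcount := congrArg (count c) h
      simp only [count_mul, hv.count_eq_one, hv'.count_eq_one, count_letter_self] at hcount
      exact absurd (refl_of R c) (hcs c (by omega))

theorem IsPyramid.eq_of_dvd_of_dvd [Std.Refl R] {a : α} {v v' x : TraceMonoid R}
    (hv : IsPyramid a v) (hv' : IsPyramid a v') (h : v ∣ x) (h' : v' ∣ x) : v = v' := by
  obtain ⟨r, rfl⟩ := h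
  obtain ⟨s, hrs⟩ := h'
  exact hv.eq_of_mul_eq_mul hv' hrs

/-- The factor `y` collects the elements of the heap of `z` that lie below some element of `v`. -/
theorem IsPyramid.exists_split {a : α} {v z : TraceMonoid R} (hv : IsPyramid a v)
    (hz : count a z = 0) : ∃ y z', z = y * z' ∧ IsPyramid a (y * v) ∧ Commute z' v := by
  induction z using induction_left with
  | one => exact ⟨1, 1, by simp, by simpa using hv, .one_left v⟩
  | letter_mul b z ih =>
    simp only [count_mul, Nat.add_eq_zero_iff] at hz
    obtain ⟨y, z', rfl, hyv, hz'v⟩ := ih hz.2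
    have hb : b ≠ a := by
      rintro rfl
      simp at hz
    by_cases hu : Unrelated b (y * v)
    · rw [unrelated_mul] at hu
      exact ⟨y, letter R b * z', hu.1.commute.left_comm z', hyv, hu.2.commute.mul_left hz'v⟩
    · exact ⟨letter R b * y, z', (mul_assoc _ _ _).symm,
        by rw [mul_assoc]; exact hyv.letter_mul hb hu, hz'v⟩

theorem exists_isPyramid_dvd {a : α} {x : TraceMonoid R} (hx : 0 < count a x) :
    ∃ v, IsPyramid a v ∧ v ∣ x := by
  induction x using induction_left with
  | one => simp at hx
  | letter_mul b x ih =>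
    by_cases hb : b = a
    · exact ⟨letter R b, hb ▸ isPyramid_letter a, x, rfl⟩
    · rw [count_mul, count_letter_of_ne hb, zero_add] at hx
      obtain ⟨v, hv, n, rfl⟩ := ih hx
      by_cases hu : Unrelated b v
      · exact ⟨v, hv, letter R b * n, hu.commute.left_comm n⟩
      · exact ⟨letter R b * v, hv.letter_mul hb hu, mul_dvd_mul_left _ (dvd_mul_right v n)⟩

theorem IsPyramid.exists_mul_count_pos {a b : α} {v : TraceMonoid R} (hv : IsPyramid a v)
    (h : (SimpleGraph.fromRel R).Reachable a b) :
    ∃ y, IsPyramid a (y * v) ∧ 0 < count b (y * v) := by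
  rw [SimpleGraph.reachable_iff_reflTransGen] at h
  induction h with
  | refl => exact ⟨1, by simpa using hv, by simp [hv.count_eq_one]⟩
  | @tail c d _ hcd ih =>
    obtain ⟨y, hyv, hc⟩ := ih
    obtain rfl | hda := eq_or_ne d a
    · exact ⟨y, hyv, by simp [hyv.count_eq_one]⟩
    · have hdc : R d c := hcd.2.elim (symm_of R) id
      refine ⟨letter R d * y, ?_, by simp⟩
      rw [mul_assoc]
      exact hyv.letter_mul hda fun hu => hu c hc hdc

theorem exists_isPyramid_forall_count_pos [Finite α] (hR : (SimpleGraph.fromRel R).Connected)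
    (a : α) : ∃ v : TraceMonoid R, IsPyramid a v ∧ ∀ b, 0 < count b v := by
  classical
  have of_finset (T : Finset α) : ∃ v : TraceMonoid R, IsPyramid a v ∧ ∀ b ∈ T, 0 < count b v := by
    induction T using Finset.induction_on with
    | empty => exact ⟨letter R a, isPyramid_letter a, by simp⟩
    | insert b T _ ih =>
      obtain ⟨v, hv, hT⟩ := ih
      obtain ⟨y, hyv, hb⟩ := hv.exists_mul_count_pos (hR.preconnected a b)
      refine ⟨y * v, hyv, fun c hc => ?_⟩
      obtain rfl | hc := Finset.mem_insert.1 hc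
      · exact hb
      · simp [hT c hc]
  cases nonempty_fintype α
  simpa using of_finset Finset.univ

theorem IsPyramid.mul_left_of_forall_count_pos [Std.Refl R] {a : α} {v z : TraceMonoid R}
    (hv : IsPyramid a v) (hcount : ∀ b, 0 < count b v) (hz : count a z = 0) :
    IsPyramid a (z * v) := by
  induction z using induction_left with
  | one => simpa using hv
  | letter_mul b z ih =>
    simp only [count_mul, Nat.add_eq_zero_iff] at hz
    have hb : b ≠ a := by
      rintro rfl
      simp at hz
    rw [mul_assoc]
    exact (ih hz.2).letter_mul hb fun hu => hu b (by simp [hcount b]) (refl_of R b)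

end Symm

/-! ### Heaps of words -/

theorem HeapLE.le {w : List α} {i j : Fin w.length} (h : HeapLE R w i j) : i ≤ j := by
  induction h with
  | refl => exact le_rfl
  | tail _ h ih => exact ih.trans h.1

theorem HeapLE.exists_succ {b : α} {w : List α} {i : Fin w.length} {k : Fin (b :: w).length}
    (h : HeapLE R (b :: w) i.succ k) : ∃ j : Fin w.length, k = j.succ ∧ HeapLE R w i j := by
  induction h with
  | refl => exact ⟨i, rfl, .refl⟩
  | @tail k l _ hkl ih =>
    obtain ⟨j, rfl, hij⟩ := ih
    have hl : 0 < l := (Fin.succ_pos j).trans_le hkl.1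
    obtain ⟨l, rfl⟩ := Fin.exists_succ_eq.2 (Fin.pos_iff_ne_zero.1 hl)
    exact ⟨l, rfl, hij.tail ⟨Fin.succ_le_succ_iff.1 hkl.1, hkl.2⟩⟩

theorem heapLE_succ_succ {b : α} {w : List α} {i j : Fin w.length} :
    HeapLE R (b :: w) i.succ j.succ ↔ HeapLE R w i j := by
  constructor
  · intro h
    obtain ⟨k, hk, hik⟩ := h.exists_succ
    rwa [Fin.succ_inj.1 hk]
  · exact Relation.ReflTransGen.lift (p := fun i j : Fin (b :: w).length => i ≤ j ∧ _) Fin.succ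
      (fun i j hij => ⟨Fin.succ_le_succ_iff.2 hij.1, hij.2⟩) i j

theorem heapLE_zero_succ {b : α} {w : List α} {i : Fin w.length} :
    HeapLE R (b :: w) (0 : Fin (w.length + 1)) i.succ ↔ ∃ j, R b (w.get j) ∧ HeapLE R w j i := by
  constructor
  · have of_eq_zero {k : Fin (b :: w).length} (hk : HeapLE R (b :: w) k i.succ) :
        k = (0 : Fin (w.length + 1)) → ∃ j, R b (w.get j) ∧ HeapLE R w j i := by
      induction hk using Relation.ReflTransGen.head_induction_on with
      | refl => exact fun hi => absurd hi (Fin.succ_ne_zero i)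
      | @head k l hkl hl ih =>
        rintro rfl
        induction l using Fin.cases with
        | zero => exact ih rfl
        | succ j => exact ⟨j, hkl.2, heapLE_succ_succ.1 hl⟩
    exact fun h => of_eq_zero h rfl
  · rintro ⟨j, hbj, hji⟩
    exact .head (b := j.succ) ⟨Fin.zero_le _, hbj⟩ (heapLE_succ_succ.2 hji)

theorem mem_belowWord {w : List α} {i : Fin w.length} {c : α} :
    c ∈ belowWord R w i ↔ ∃ j, HeapLE R w j i ∧ w.get j = c := by
  simp [belowWord]

theorem belowWord_zero (b : α) (w : List α) :
    belowWord R (b :: w) (0 : Fin (w.length + 1)) = [b] := by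
  have not_le (j : Fin w.length) : ¬ HeapLE R (b :: w) j.succ (0 : Fin (w.length + 1)) :=
    fun hj => (Fin.succ_pos j).not_ge hj.le
  have zero_le : HeapLE R (b :: w) (0 : Fin (w.length + 1)) (0 : Fin (w.length + 1)) := .refl
  simp [belowWord, List.finRange_succ, List.filter_map, Function.comp_def, zero_le, not_le]

open Classical in
theorem belowWord_succ (b : α) (w : List α) (i : Fin w.length) :
    belowWord R (b :: w) i.succ =
      if ∃ c ∈ belowWord R w i, R b c then b :: belowWord R w i else belowWord R w i := by
  have hb : (∃ c ∈ belowWord R w i, R b c) ↔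
      HeapLE R (b :: w) (0 : Fin (w.length + 1)) i.succ := by
    simp only [heapLE_zero_succ, mem_belowWord]
    grind
  rw [if_congr hb rfl rfl]
  split_ifs with h <;>
  simp [belowWord, List.finRange_succ, List.filter_map, Function.comp_def, heapLE_succ_succ, h]

theorem word_belowWord_dvd (w : List α) (i : Fin w.length) :
    word R (belowWord R w i) ∣ word R w := by
  classical
  induction w with
  | nil => exact i.elim0
  | cons b w ih =>
    induction i using Fin.cases with
    | zero => exact ⟨word R w, by rw [belowWord_zero, word_singleton, word_cons]⟩
    | succ i =>
      rw [belowWord_succ, word_cons]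
      split_ifs with h
      · exact mul_dvd_mul_left _ (ih i)
      · have hb : Unrelated b (word R (belowWord R w i)) := by
          rw [unrelated_word]
          grind
        obtain ⟨n, hn⟩ := ih i
        exact ⟨letter R b * n, by rw [hn, hb.commute.left_comm]⟩

theorem exists_get_eq_and_le {a : α} {w : List α} (ha : a ∈ w) :
    ∃ i : Fin w.length, w.get i = a ∧ ∀ j, w.get j = a → i ≤ j := by
  obtain ⟨i, hi, hmin⟩ := wellFounded_lt.has_min {j : Fin w.length | w.get j = a}
    (List.get_of_mem ha)
  exact ⟨i, hi, fun j hj => not_lt.1 (hmin j hj)⟩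

theorem isPyramid_belowWord [Std.Symm R] (w : List α) (i : Fin w.length)
    (h : ∀ j, w.get j = w.get i → i ≤ j) : IsPyramid (w.get i) (word R (belowWord R w i)) := by
  classical
  induction w with
  | nil => exact i.elim0
  | cons b w ih =>
    induction i using Fin.cases with
    | zero =>
      rw [belowWord_zero]
      exact isPyramid_letter b
    | succ i =>
      have hi : IsPyramid (w.get i) (word R (belowWord R w i)) :=
        ih i fun j hj => Fin.succ_le_succ_iff.1 (h j.succ hj)
      have hb : b ≠ w.get i := fun hb =>
        (Fin.succ_pos i).not_ge (h (0 : Fin (w.length + 1)) hb)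
      rw [belowWord_succ]
      split_ifs with hrel
      · refine hi.letter_mul hb ?_
        rw [unrelated_word]
        grind
      · exact hi

theorem isV_iff [Std.Refl R] [Std.Symm R] {a : α} {x y : TraceMonoid R} :
    IsV a x y ↔ IsPyramid a y ∧ y ∣ x := by
  constructor
  · rintro ⟨w, rfl, i, rfl, h, rfl⟩
    exact ⟨isPyramid_belowWord w i fun j hj => (h j hj).le, word_belowWord_dvd w i⟩
  · rintro ⟨hy, n, rfl⟩
    obtain ⟨w, hw⟩ := word_surjective (y * n)
    have ha : a ∈ w := by
      rw [← count_word_pos (R := R), hw, count_mul, hy.count_eq_one]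
      omega
    obtain ⟨i, rfl, hmin⟩ := exists_get_eq_and_le ha
    refine ⟨w, hw, i, rfl, fun j hj => .single ⟨hmin j hj, hj ▸ refl_of R _⟩, ?_⟩
    exact hy.eq_of_dvd_of_dvd (isPyramid_belowWord w i hmin) (hw ▸ dvd_mul_right y n)
      (word_belowWord_dvd w i)

theorem mem_pyr_iff [Std.Refl R] [Std.Symm R] {a : α} {v : TraceMonoid R} :
    v ∈ Pyr R a ↔ IsPyramid a v := by
  constructor
  · rintro ⟨x, -, h⟩
    exact (isV_iff.1 h).1
  · exact fun h => ⟨v, by simp [h.count_eq_one], isV_iff.2 ⟨h, dvd_rfl⟩⟩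

theorem endsWith_of_maximal (w : List α) (i : Fin w.length)
    (h : ∀ j, HeapLE R w i j → j = i) : EndsWith (w.get i) (word R w) := by
  induction w with
  | nil => exact i.elim0
  | cons b w ih =>
    rw [word_cons]
    induction i using Fin.cases with
    | zero =>
      refine (endsWith_letter.2 rfl).mul_of_unrelated (unrelated_word.2 fun c hc hbc => ?_)
      obtain ⟨j, rfl⟩ := List.get_of_mem hc
      exact absurd (h j.succ (.single ⟨Fin.zero_le _, hbc⟩)) (Fin.succ_ne_zero j)
    | succ i =>
      exact (ih i fun j hj => Fin.succ_inj.1 (h j.succ (heapLE_succ_succ.2 hj))).mul_left _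

theorem maxIn_iff {U : Set α} {x : TraceMonoid R} : MaxIn U x ↔ ∀ c, EndsWith c x → c ∈ U := by
  constructor
  · rintro h c ⟨y, rfl⟩
    obtain ⟨w, rfl⟩ := word_surjective y
    have hlast := h (w ++ [c]) rfl ⟨w.length, by simp⟩ fun j hj => by
      have hle : w.length ≤ j := hj.le
      have hlt := j.2
      simp only [List.length_append, List.length_singleton] at hlt
      exact Fin.ext (show (j : ℕ) = w.length by omega)
    simpa using hlast
  · rintro h w rfl i hi
    exact h _ (endsWith_of_maximal w i hi)

theorem isPyramid_mul_letter_iff [Std.Refl R] [Std.Symm R] {a : α} {z : TraceMonoid R} :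
    IsPyramid a (z * letter R a) ↔ count a z = 0 ∧ MaxIn (link R a) z := by
  rw [maxIn_iff]
  constructor
  · refine fun h => ⟨by simpa using h.count_eq_one, fun c hc => ?_⟩
    by_contra hac
    have hca : ¬ R c a := fun hca => hac (symm_of R hca)
    rw [h.eq_of_endsWith (hc.mul_of_unrelated (unrelated_letter.2 hca))] at hac
    exact hac (refl_of R a)
  · rintro ⟨hcount, hmax⟩
    refine ⟨endsWith_mul_letter a z, by simp [hcount], fun hc => ?_⟩
    obtain hca | ⟨hca, hcz⟩ := hc.of_mul
    · exact (endsWith_letter.1 hca).symm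
    · exact absurd (symm_of R (hmax _ hcz)) (unrelated_letter.1 hca)

/-! ### Möbius polynomials -/

open Classical in
theorem filter_pairwise_insert [Std.Symm R] {b : α} {T : Finset α} (hb : b ∉ T) :
    T.powerset.filter (fun γ : Finset α => (↑(insert b γ) : Set α).Pairwise fun c d => ¬ R c d) =
      (T.filter fun c => ¬ R b c).powerset.filter
        fun γ : Finset α => (γ : Set α).Pairwise fun c d => ¬ R c d := by
  ext γ
  have pairwise_iff (hγ : γ ⊆ T) : ((insert b γ : Finset α) : Set α).Pairwise (fun c d => ¬ R c d) ↔
      (γ : Set α).Pairwise (fun c d => ¬ R c d) ∧ ∀ c ∈ γ, ¬ R b c := by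
    have : Std.Symm fun c d => ¬ R c d := ⟨fun c d h hdc => h (symm_of R hdc)⟩
    rw [Finset.coe_insert, Set.pairwise_insert_of_symm]
    exact and_congr_right' (forall₂_congr fun c hc =>
      forall_prop_of_true (ne_of_mem_of_not_mem (hγ hc) hb).symm)
  simp only [Finset.mem_filter, Finset.mem_powerset, Finset.subset_iff]
  grind

open Classical in
theorem mobius_insert [Std.Symm R] {b : α} {T : Finset α} (hb : b ∉ T) :
    mobius R (insert b T) = mobius R T - Polynomial.X * mobius R {c ∈ T | ¬ R b c} := by
  have card_insert (γ : Finset α) (hγ : γ ∈ T.powerset) : (insert b γ).card = γ.card + 1 :=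
    Finset.card_insert_of_notMem fun h => hb (Finset.mem_powerset.1 hγ h)
  simp only [mobius]
  rw [← filter_pairwise_insert hb, Finset.mul_sum, sub_eq_add_neg, ← Finset.sum_neg_distrib]
  simp only [Finset.sum_filter]
  rw [Finset.sum_powerset_insert hb]
  congr 1
  refine Finset.sum_congr rfl fun γ hγ => ?_
  simp only [card_insert γ hγ, pow_succ', neg_mul]

@[simp]
theorem mobius_empty : mobius R (∅ : Finset α) = 1 := by
  classical
  simp [mobius, Finset.filter_singleton]

theorem eval_zero_mobius [Std.Symm R] (S : Finset α) : (mobius R S).eval 0 = 1 := by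
  classical
  induction S using Finset.induction_on with
  | empty => simp
  | insert b T hb ih => simp [mobius_insert hb, ih]

theorem mobius_ne_zero [Std.Symm R] (S : Finset α) : mobius R S ≠ 0 := fun h => by
  simpa [h] using eval_zero_mobius (R := R) S

/-! ### Growth series and Cartier–Foata inversion -/

/-- The growth series of a set of traces, evaluated at `t`; it is meaningful where it is
summable. -/
def growthSeries {𝕜 : Type*} [Semiring 𝕜] [TopologicalSpace 𝕜] (A : Set (TraceMonoid R))
    (t : 𝕜) : 𝕜 :=
  ∑' x : A, t ^ len (x : TraceMonoid R)

/-- Convergence of the growth series of a set of traces at a nonnegative real number. -/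
def GrowthSummable (A : Set (TraceMonoid R)) (t : ℝ) : Prop :=
  Summable fun x : A => t ^ len (x : TraceMonoid R)

theorem GrowthSummable.mono {A B : Set (TraceMonoid R)} {t : ℝ} (hB : GrowthSummable B t)
    (hAB : A ⊆ B) : GrowthSummable A t :=
  hB.comp_injective (i := Set.inclusion hAB) (Set.inclusion_injective hAB)

/-- The traces of `M_S` with no last letter in `T`. -/
def avoiding (R : α → α → Prop) (S T : Set α) : Set (TraceMonoid R) :=
  {x | x ∈ sub R S ∧ ∀ c ∈ T, ¬ EndsWith c x}

theorem avoiding_subset (S T : Set α) : avoiding R S T ⊆ sub R S := fun _ h => h.1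

@[simp]
theorem avoiding_empty (S : Set α) : avoiding R S ∅ = sub R S := by
  ext x
  simp [avoiding]

theorem avoiding_self (S : Set α) : avoiding R S S = {1} := by
  ext x
  constructor
  · rintro ⟨hxS, hx⟩
    by_contra hne
    obtain ⟨c, hc⟩ := exists_endsWith hne
    exact hx c (mem_sub_iff.1 hxS c hc.count_pos) hc
  · rintro rfl
    exact ⟨Submonoid.one_mem _, fun c _ hc => by simpa using hc.count_pos⟩

theorem disjoint_avoiding_insert_image (S T : Set α) (b : α) (A : Set (TraceMonoid R)) :
    Disjoint (avoiding R S (insert b T)) ((· * letter R b) '' A) := by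
  rw [Set.disjoint_left]
  rintro _ hx ⟨z, -, rfl⟩
  exact hx.2 b (Set.mem_insert _ _) (endsWith_mul_letter b z)

theorem avoiding_eq_union [Std.Symm R] {S T : Set α} {b : α} (hbS : b ∈ S) (hbT : b ∉ T) :
    avoiding R S T =
      avoiding R S (insert b T) ∪ (· * letter R b) '' avoiding R S {c ∈ T | ¬ R b c} := by
  ext x
  constructor
  · rintro ⟨hxS, hx⟩
    by_cases hb : EndsWith b x
    · obtain ⟨z, rfl⟩ := hb
      refine .inr ⟨z, ⟨(mul_mem_sub_iff.1 hxS).1, fun c hc hcz => hx c hc.1 ?_⟩, rfl⟩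
      exact hcz.mul_of_unrelated (unrelated_letter.2 fun hcb => hc.2 (symm_of R hcb))
    · exact .inl ⟨hxS, Set.forall_mem_insert.2 ⟨hb, hx⟩⟩
  · rintro (⟨hxS, hx⟩ | ⟨z, ⟨hzS, hz⟩, rfl⟩)
    · exact ⟨hxS, fun c hc => hx c (Set.mem_insert_of_mem b hc)⟩
    · refine ⟨mul_mem_sub_iff.2 ⟨hzS, letter_mem_sub_iff.2 hbS⟩, fun c hc hcz => ?_⟩
      obtain hcb | ⟨hcb, hcz⟩ := hcz.of_mul
      · exact hbT (endsWith_letter.1 hcb ▸ hc)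
      · exact hz c ⟨hc, fun hbc => unrelated_letter.1 hcb (symm_of R hbc)⟩ hcz

theorem growthSeries_singleton {𝕜 : Type*} [Semiring 𝕜] [TopologicalSpace 𝕜] (x : TraceMonoid R)
    (t : 𝕜) : growthSeries {x} t = t ^ len x :=
  tsum_singleton x fun y => t ^ len y

theorem growthSeries_image_mul_right {𝕜 : Type*} [DivisionRing 𝕜] [TopologicalSpace 𝕜]
    [IsTopologicalRing 𝕜] [T2Space 𝕜] (A : Set (TraceMonoid R)) (y : TraceMonoid R) (t : 𝕜) :
    growthSeries ((· * y) '' A) t = t ^ len y * growthSeries A t := by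
  rw [growthSeries, growthSeries, tsum_image (fun x => t ^ len x) (mul_left_injective y).injOn,
    ← tsum_mul_left]
  simp only [len_mul, add_comm, pow_add]

section NormedField

variable {𝕜 : Type*} [NormedField 𝕜] [CompleteSpace 𝕜] {t : 𝕜}

theorem GrowthSummable.summable {A : Set (TraceMonoid R)} (h : GrowthSummable A ‖t‖) :
    Summable fun x : A => t ^ len (x : TraceMonoid R) :=
  .of_norm <| h.congr fun _ => (norm_pow t _).symm

theorem growthSeries_union {A B : Set (TraceMonoid R)} (hAB : Disjoint A B)
    (h : GrowthSummable (A ∪ B) ‖t‖) :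
    growthSeries (A ∪ B) t = growthSeries A t + growthSeries B t :=
  Summable.tsum_union_disjoint (f := fun x : TraceMonoid R => t ^ len x) hAB
    (h.mono Set.subset_union_left).summable (h.mono Set.subset_union_right).summable

theorem growthSeries_avoiding [Std.Symm R] {S T : Set α} {b : α}
    (h : GrowthSummable (R := R) (sub R S) ‖t‖)
    (hbS : b ∈ S) (hbT : b ∉ T) :
    growthSeries (avoiding R S T) t = growthSeries (avoiding R S (insert b T)) t +
      t * growthSeries (avoiding R S {c ∈ T | ¬ R b c}) t := by
  have hT : GrowthSummable (avoiding R S T) ‖t‖ := h.mono (avoiding_subset S T)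
  rw [avoiding_eq_union hbS hbT] at hT ⊢
  rw [growthSeries_union (disjoint_avoiding_insert_image S T b _) hT, growthSeries_image_mul_right,
    len_letter, pow_one]

variable [Algebra ℝ 𝕜]

theorem aeval_mobius_mul_growthSeries [Std.Symm R] {S : Set α}
    (h : GrowthSummable (R := R) (sub R S) ‖t‖)
    (T : Finset α) (hT : (T : Set α) ⊆ S) :
    Polynomial.aeval t (mobius R T) * growthSeries (R := R) (sub R S) t =
      growthSeries (avoiding R S T) t := by
  classical
  induction T using Finset.strongInduction with
  | H T ih =>
    obtain rfl | ⟨b, hb⟩ := T.eq_empty_or_nonempty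
    · simp
    · obtain ⟨U, hbU, rfl⟩ : ∃ U, b ∉ U ∧ insert b U = T :=
        ⟨T.erase b, Finset.notMem_erase _ _, Finset.insert_erase hb⟩
      have hU : U ⊂ insert b U := Finset.ssubset_insert hbU
      have hfilter : {c ∈ U | ¬ R b c} ⊆ U := Finset.filter_subset _ _
      have hUS : (U : Set α) ⊆ S := (Finset.coe_subset.2 hU.1).trans hT
      have ihU := ih U hU hUS
      have ihfilter := ih _ (hfilter.trans_ssubset hU) ((Finset.coe_subset.2 hfilter).trans hUS)
      rw [Finset.coe_filter] at ihfilter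
      have hsplit := growthSeries_avoiding h (hT (by simp)) (Finset.mem_coe.not.2 hbU)
      simp only [Finset.mem_coe] at hsplit
      rw [mobius_insert hbU, map_sub, map_mul, Polynomial.aeval_X, Finset.coe_insert]
      linear_combination ihU - t * ihfilter + hsplit

theorem aeval_mobius_mul_growthSeries_self [Std.Symm R] {S : Finset α}
    (h : GrowthSummable (R := R) (sub R (S : Set α)) ‖t‖) :
    Polynomial.aeval t (mobius R S) * growthSeries (R := R) (sub R (S : Set α)) t = 1 := by
  rw [aeval_mobius_mul_growthSeries h S subset_rfl, avoiding_self, growthSeries_singleton, len_one,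
    pow_zero]

end NormedField

/-! ### The radius of convergence -/

/-- The number of traces of length `n` in `A`, or `0` if there are infinitely many. -/
def numTraces (A : Set (TraceMonoid R)) (n : ℕ) : ℕ :=
  Nat.card {x : A // len (x : TraceMonoid R) = n}

theorem tsum_len_fiber {𝕜 : Type*} [NormedField 𝕜] (A : Set (TraceMonoid R)) (t : 𝕜) (n : ℕ) :
    ∑' x : {x : A // len (x : TraceMonoid R) = n}, t ^ len (x : TraceMonoid R) =
      numTraces A n * t ^ n := by
  rw [tsum_congr fun x => by rw [x.2], tsum_const, nsmul_eq_mul, numTraces]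

theorem hasSum_numTraces {𝕜 : Type*} [NormedField 𝕜] [CompleteSpace 𝕜] {t : 𝕜}
    {A : Set (TraceMonoid R)} (h : GrowthSummable A ‖t‖) :
    HasSum (fun n => numTraces A n * t ^ n) (growthSeries A t) :=
  (h.summable.hasSum.tsum_fiberwise fun x : A => len (x : TraceMonoid R)).congr_fun fun n =>
    (tsum_len_fiber A t n).symm

theorem growthSummable_of_numTraces {A : Set (TraceMonoid R)}
    [∀ n, Finite {x : A // len (x : TraceMonoid R) = n}] {t : ℝ} (ht : 0 ≤ t)
    (h : Summable fun n => numTraces A n * t ^ n) : GrowthSummable A t := by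
  rw [GrowthSummable, ← (Equiv.sigmaFiberEquiv fun x : A => len (x : TraceMonoid R)).summable_iff]
  refine (summable_sigma_of_nonneg fun x => pow_nonneg ht _).2 ⟨fun n => .of_finite, ?_⟩
  exact h.congr fun n => (tsum_len_fiber A t n).symm

/-- The trace in `M_S` of a word of length `n` over `S`. -/
def vectorTrace (R : α → α → Prop) (S : Set α) (n : ℕ) (w : List.Vector S n) :
    {x : (sub R S : Set (TraceMonoid R)) // len (x : TraceMonoid R) = n} :=
  ⟨⟨word R (w.toList.map (↑)), word_mem_sub_iff.2 (by simp +contextual)⟩, by simp⟩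

theorem vectorTrace_surjective (S : Set α) (n : ℕ) :
    Function.Surjective (vectorTrace R S n) := by
  rintro ⟨⟨x, hx⟩, hn⟩
  obtain ⟨w, rfl⟩ := word_surjective x
  lift w to List S using word_mem_sub_iff.1 hx
  exact ⟨⟨w, by simpa using hn⟩, rfl⟩

instance (S : Finset α) (n : ℕ) :
    Finite {x : (sub R (S : Set α) : Set (TraceMonoid R)) // len (x : TraceMonoid R) = n} :=
  .of_surjective _ (vectorTrace_surjective (S : Set α) n)

theorem numTraces_sub_le (S : Finset α) (n : ℕ) :
    numTraces (R := R) (sub R (S : Set α)) n ≤ S.card ^ n := by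
  refine (Nat.card_le_card_of_surjective _ (vectorTrace_surjective (S : Set α) n)).trans_eq ?_
  simp

theorem growthSummable_sub_of_card_mul_lt_one {S : Finset α} {t : ℝ} (ht : 0 ≤ t)
    (h : S.card * t < 1) : GrowthSummable (R := R) (sub R (S : Set α)) t := by
  refine growthSummable_of_numTraces ht <| .of_nonneg_of_le (fun n => by positivity) (fun n => ?_)
    (summable_geometric_of_lt_one (by positivity) h)
  rw [mul_pow]
  gcongr
  exact_mod_cast numTraces_sub_le S n

theorem lt_pRoot_iff [Std.Symm R] {S : Finset α} {c : ℝ≥0∞} (hc : c < ⊤) :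
    c < pRoot R S ↔ ∀ z : ℂ, Polynomial.aeval z (mobius R S) = 0 → c < ‖z‖ₑ := by
  refine ⟨fun h z hz => h.trans_le (iInf₂_le z hz), fun h => ?_⟩
  have hmem (z : ℂ) : z ∈ (mobius R S).aroots ℂ ↔ Polynomial.aeval z (mobius R S) = 0 := by
    simp [mobius_ne_zero]
  calc c < ((mobius R S).aroots ℂ).toFinset.inf fun z => ‖z‖ₑ :=
        (Finset.lt_inf_iff hc).2 fun z hz => h z <| (hmem z).1 <| Multiset.mem_toFinset.1 hz
    _ ≤ pRoot R S := le_iInf₂ fun z hz => Finset.inf_le <| Multiset.mem_toFinset.2 <| (hmem z).2 hz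

theorem exists_root_enorm_eq_pRoot [Std.Symm R] {S : Finset α} (hS : pRoot R S < ⊤) :
    ∃ z : ℂ, Polynomial.aeval z (mobius R S) = 0 ∧ ‖z‖ₑ = pRoot R S := by
  by_contra! h
  exact lt_irrefl _ <| (lt_pRoot_iff hS).2 fun z hz => (iInf₂_le z hz).lt_of_ne (h z hz).symm

theorem hasFPowerSeriesAt_inv_mobius [Std.Symm R] (S : Finset α) :
    HasFPowerSeriesAt (fun z : ℂ => (Polynomial.aeval z (mobius R S))⁻¹)
      (.ofScalars ℂ fun n => (numTraces (R := R) (sub R (S : Set α)) n : ℂ)) 0 := by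
  rw [hasFPowerSeriesAt_iff]
  have hε : 0 < 1 / (S.card + 1 : ℝ) := by positivity
  filter_upwards [Metric.ball_mem_nhds (0 : ℂ) hε] with z hz
  rw [mem_ball_zero_iff, lt_div_iff₀ (by positivity)] at hz
  have hsum : GrowthSummable (R := R) (sub R (S : Set α)) ‖z‖ :=
    growthSummable_sub_of_card_mul_lt_one (norm_nonneg z) (by nlinarith [norm_nonneg z])
  rw [zero_add, ← eq_inv_of_mul_eq_one_right (aeval_mobius_mul_growthSeries_self hsum)]
  simpa [FormalMultilinearSeries.coeff_ofScalars, mul_comm] using hasSum_numTraces hsum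

theorem growthSummable_of_lt_pRoot [Std.Symm R] {S : Finset α} {t : ℝ} (ht : 0 ≤ t)
    (h : ENNReal.ofReal t < pRoot R S) : GrowthSummable (R := R) (sub R (S : Set α)) t := by
  obtain ⟨r, htr, hr⟩ := ENNReal.lt_iff_exists_nnreal_btwn.1 h
  have htr' : t < r := (ENNReal.ofReal_lt_coe_iff ht).1 htr
  have hr0 : 0 < r := by exact_mod_cast ht.trans_lt htr'
  have hne (z : ℂ) (hz : z ∈ Metric.closedBall 0 (r : ℝ)) :
      Polynomial.aeval z (mobius R S) ≠ 0 := fun hz0 => by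
    have hlt := (lt_pRoot_iff ENNReal.coe_lt_top).1 hr z hz0
    rw [enorm_eq_nnnorm, ENNReal.coe_lt_coe] at hlt
    exact (mem_closedBall_zero_iff.1 hz).not_gt hlt
  have hdiff : DifferentiableOn ℂ (fun z : ℂ => (Polynomial.aeval z (mobius R S))⁻¹)
      (Metric.closedBall 0 r) :=
    (Polynomial.differentiable_aeval _).differentiableOn.inv hne
  have hball := hdiff.hasFPowerSeriesOnBall hr0
  have hsum := (hball.hasSum (y := (t : ℂ)) (by
    simpa [Metric.mem_eball, abs_of_nonneg ht] using htr')).summable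
  rw [hball.hasFPowerSeriesAt.eq_formalMultilinearSeries (hasFPowerSeriesAt_inv_mobius S)] at hsum
  simp only [FormalMultilinearSeries.ofScalars_apply_eq, smul_eq_mul] at hsum
  exact growthSummable_of_numTraces ht (Complex.summable_ofReal.1 (by simpa using hsum))

theorem growthSummable_sub_iff [Std.Symm R] {S : Finset α} {t : ℝ} (ht : 0 ≤ t) :
    GrowthSummable (R := R) (sub R (S : Set α)) t ↔ ENNReal.ofReal t < pRoot R S := by
  refine ⟨fun h => (lt_pRoot_iff ENNReal.ofReal_lt_top).2 fun z hz => ?_,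
    growthSummable_of_lt_pRoot ht⟩
  by_contra! hzt
  rw [← ofReal_norm, ENNReal.ofReal_le_ofReal_iff ht] at hzt
  have hsum : GrowthSummable (R := R) (sub R (S : Set α)) ‖z‖ :=
    .of_nonneg_of_le (fun _ => by positivity) (fun _ => by gcongr) h
  simpa [hz] using aeval_mobius_mul_growthSeries_self hsum

theorem pRoot_pos [Std.Symm R] (S : Finset α) : 0 < pRoot R S := by
  rw [← ENNReal.ofReal_zero, ← growthSummable_sub_iff le_rfl]
  exact growthSummable_sub_of_card_mul_lt_one le_rfl (by simp)

theorem pRoot_lt_top [Std.Symm R] {S : Finset α} (hS : S.Nonempty) : pRoot R S < ⊤ := by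
  obtain ⟨a, ha⟩ := hS
  refine lt_of_not_ge fun htop => ?_
  have hsum : GrowthSummable (R := R) (sub R (S : Set α)) 1 :=
    (growthSummable_sub_iff zero_le_one).2 (ENNReal.ofReal_lt_top.trans_le htop)
  have hinf : Infinite (sub R (S : Set α) : Set (TraceMonoid R)) :=
    .of_surjective (fun x => len (x : TraceMonoid R)) fun n =>
      ⟨⟨word R (List.replicate n a), word_mem_sub_iff.2 (by simp_all)⟩, by simp⟩
  simp [GrowthSummable, summable_const_iff] at hsum

theorem growthSeries_nonneg {t : ℝ} (ht : 0 ≤ t) (A : Set (TraceMonoid R)) :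
    0 ≤ growthSeries A t :=
  tsum_nonneg fun _ => pow_nonneg ht _

section RealPoints

variable [Std.Symm R] {S : Finset α} {t : ℝ}

theorem eval_mobius_mul_growthSeries (ht : 0 ≤ t) (h : ENNReal.ofReal t < pRoot R S) :
    (mobius R S).eval t * growthSeries (R := R) (sub R (S : Set α)) t = 1 := by
  have hsum := (growthSummable_sub_iff ht).2 h
  rw [← Real.norm_of_nonneg ht] at hsum
  simpa using aeval_mobius_mul_growthSeries_self hsum

theorem eval_mobius_pos (ht : 0 ≤ t) (h : ENNReal.ofReal t < pRoot R S) :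
    0 < (mobius R S).eval t :=
  pos_of_mul_pos_left (by rw [eval_mobius_mul_growthSeries ht h]; exact one_pos)
    (growthSeries_nonneg ht _)

theorem eval_le_eval_of_forall_lt_pRoot {f g : ℝ → ℝ} (hf : Continuous f) (hg : Continuous g)
    (hfg : ∀ t, 0 ≤ t → ENNReal.ofReal t < pRoot R S → f t ≤ g t) (hS : pRoot R S < ⊤) :
    f (pRoot R S).toReal ≤ g (pRoot R S).toReal := by
  have hpos : 0 < (pRoot R S).toReal := ENNReal.toReal_pos (pRoot_pos S).ne' hS.ne
  refine le_on_closure (s := Set.Ico 0 (pRoot R S).toReal) (fun t ht => ?_) hf.continuousOn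
    hg.continuousOn ?_
  · exact hfg t ht.1 ((ENNReal.ofReal_lt_iff_lt_toReal ht.1 hS.ne).2 ht.2)
  · rw [closure_Ico hpos.ne]
    exact ⟨hpos.le, le_rfl⟩

theorem eval_mobius_norm_le {z : ℂ} (h : ENNReal.ofReal ‖z‖ < pRoot R S) :
    (mobius R S).eval ‖z‖ ≤ ‖Polynomial.aeval z (mobius R S)‖ := by
  have hsum := (growthSummable_sub_iff (norm_nonneg z)).2 h
  have hreal := eval_mobius_mul_growthSeries (norm_nonneg z) h
  have hcomplex := congrArg norm (aeval_mobius_mul_growthSeries_self hsum)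
  rw [norm_mul, norm_one] at hcomplex
  have hle : ‖growthSeries (R := R) (sub R (S : Set α)) z‖ ≤
      growthSeries (R := R) (sub R (S : Set α)) ‖z‖ :=
    tsum_of_norm_bounded (Summable.hasSum hsum) fun x => (norm_pow z _).le
  have hpos : 0 < growthSeries (R := R) (sub R (S : Set α)) ‖z‖ :=
    (growthSeries_nonneg (norm_nonneg z) _).lt_of_ne' (right_ne_zero_of_mul_eq_one hreal)
  refine le_of_mul_le_mul_right ?_ hpos
  rw [hreal, ← hcomplex]
  gcongr

theorem eval_mobius_pRoot (hS : pRoot R S < ⊤) : (mobius R S).eval (pRoot R S).toReal = 0 := by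
  set p := (pRoot R S).toReal
  refine le_antisymm ?_ <| eval_le_eval_of_forall_lt_pRoot continuous_const
    (mobius R S).continuous (fun t ht h => (eval_mobius_pos ht h).le) hS
  obtain ⟨z, hz, hzp⟩ := exists_root_enorm_eq_pRoot hS
  have hzp : ‖z‖ = p := by rw [← toReal_enorm, hzp]
  have hp : 0 < p := ENNReal.toReal_pos (pRoot_pos S).ne' hS.ne
  have hnorm (t : ℝ) (ht : 0 ≤ t) : ‖((t / p : ℝ) : ℂ) * z‖ = t := by
    rw [norm_mul, Complex.norm_real, hzp, Real.norm_of_nonneg (by positivity),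
      div_mul_cancel₀ _ hp.ne']
  have hlim := eval_le_eval_of_forall_lt_pRoot (R := R) (S := S)
    (g := fun t => ‖Polynomial.aeval (((t / p : ℝ) : ℂ) * z) (mobius R S)‖)
    (mobius R S).continuous (by fun_prop) (fun t ht h => ?_) hS
  · simpa [p, div_self hp.ne', hz] using hlim
  · simpa only [hnorm t ht] using eval_mobius_norm_le (z := ((t / p : ℝ) : ℂ) * z)
      (by rwa [hnorm t ht])

end RealPoints

/-! ### The growth series of the pyramidal traces -/

theorem GrowthSummable.image_mul_right {A : Set (TraceMonoid R)} {t : ℝ} (h : GrowthSummable A t)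
    (y : TraceMonoid R) : GrowthSummable ((· * y) '' A) t := by
  rw [GrowthSummable, ← (Equiv.Set.image _ A (mul_left_injective y)).summable_iff]
  refine (h.mul_right (t ^ len y)).congr fun x => ?_
  simp [pow_add]

theorem growthSeries_mono {A B : Set (TraceMonoid R)} {t : ℝ} (ht : 0 ≤ t) (hAB : A ⊆ B)
    (hB : GrowthSummable B t) : growthSeries A t ≤ growthSeries B t :=
  Summable.tsum_le_tsum_of_inj (Set.inclusion hAB) (Set.inclusion_injective hAB)
    (fun _ _ => pow_nonneg ht _) (fun _ => le_rfl) (hB.mono hAB) hB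

theorem ofReal_growthSeries {A : Set (TraceMonoid R)} {t : ℝ} (ht : 0 ≤ t)
    (hA : GrowthSummable A t) :
    ENNReal.ofReal (growthSeries A t) = growthSeries A (ENNReal.ofReal t) := by
  rw [growthSeries, ENNReal.ofReal_tsum_of_nonneg (fun _ => pow_nonneg ht _) hA]
  simp only [ENNReal.ofReal_pow ht, growthSeries]

theorem pyr_eq_image [Std.Refl R] [Std.Symm R] (a : α) :
    Pyr R a = (· * letter R a) '' {z | count a z = 0 ∧ MaxIn (link R a) z} := by
  ext v
  rw [mem_pyr_iff]
  constructor
  · intro hv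
    obtain ⟨z, rfl⟩ := hv.endsWith
    exact ⟨z, isPyramid_mul_letter_iff.1 hv, rfl⟩
  · rintro ⟨z, hz, rfl⟩
    exact isPyramid_mul_letter_iff.2 hz

section Pyr

variable [Fintype α] [DecidableEq α]

theorem mem_sub_erase {a : α} {z : TraceMonoid R} :
    z ∈ sub R ((Finset.univ.erase a : Finset α) : Set α) ↔ count a z = 0 := by
  simp only [mem_sub_iff, Finset.mem_coe, Finset.mem_erase, Finset.mem_univ, and_true]
  refine ⟨fun h => ?_, fun h b hb hba => by simp [hba, h] at hb⟩
  by_contra ha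
  exact h a (Nat.pos_of_ne_zero ha) rfl

theorem avoiding_erase (a : α) :
    avoiding R ((Finset.univ.erase a : Finset α) : Set α)
        {c | c ∈ Finset.univ.erase a ∧ ¬ R a c} =
      {z | count a z = 0 ∧ MaxIn (link R a) z} := by
  ext z
  simp only [avoiding, mem_sub_erase, maxIn_iff, Set.mem_ofPred_eq, Finset.mem_erase,
    Finset.mem_univ, and_true, link]
  refine and_congr_right fun ha => ⟨fun h c hc => ?_, fun h c hac hc => hac.2 (h c hc)⟩
  by_contra hac
  exact h c ⟨fun hca => hc.count_pos.ne' (hca ▸ ha), hac⟩ hc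

variable [Std.Refl R] [Std.Symm R] {t : ℝ}

theorem growthSummable_pyr (a : α) (ht : 0 ≤ t)
    (h : ENNReal.ofReal t < pRoot R (Finset.univ.erase a)) : GrowthSummable (Pyr R a) t := by
  rw [pyr_eq_image, ← avoiding_erase]
  exact (((growthSummable_sub_iff ht).2 h).mono (avoiding_subset _ _)).image_mul_right _

theorem eval_mobius_mul_growthSeries_pyr (a : α) (ht : 0 ≤ t)
    (h : ENNReal.ofReal t < pRoot R (Finset.univ.erase a)) :
    (mobius R (Finset.univ.erase a)).eval t * growthSeries (Pyr R a) t =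
      (mobius R (Finset.univ.erase a)).eval t - (mobius R Finset.univ).eval t := by
  classical
  have hsum := (growthSummable_sub_iff ht).2 h
  have havoid := aeval_mobius_mul_growthSeries (t := t) (by rwa [Real.norm_of_nonneg ht])
    ((Finset.univ.erase a).filter fun c => ¬ R a c)
    (Finset.coe_subset.2 (Finset.filter_subset _ _))
  rw [Finset.coe_filter, avoiding_erase, Polynomial.coe_aeval_eq_eval] at havoid
  have hsub := eval_mobius_mul_growthSeries ht h
  have hmobius : mobius R Finset.univ = mobius R (Finset.univ.erase a) -
      Polynomial.X * mobius R {c ∈ Finset.univ.erase a | ¬ R a c} := by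
    rw [← mobius_insert (Finset.notMem_erase a _)]
    congr 1
    ext c
    simp [em]
  rw [pyr_eq_image, growthSeries_image_mul_right, len_letter, pow_one, ← havoid, hmobius,
    Polynomial.eval_sub, Polynomial.eval_mul, Polynomial.eval_X]
  linear_combination t * Polynomial.eval t
    (mobius R ((Finset.univ.erase a).filter fun c => ¬ R a c)) * hsub

/-- Every `z * v` with `z` free of `a` is pyramidal, so the traces `z * v` alone contribute
`t ^ |v| / μ_{Σ∖a}(t)` to the growth series of the pyramidal traces. -/
theorem pow_len_le_sub_eval_mobius {a : α} {v : TraceMonoid R} (hv : IsPyramid a v)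
    (hcount : ∀ b, 0 < count b v) (ht : 0 ≤ t)
    (h : ENNReal.ofReal t < pRoot R (Finset.univ.erase a)) :
    t ^ len v ≤ (mobius R (Finset.univ.erase a)).eval t - (mobius R Finset.univ).eval t := by
  have hsubset : (· * v) '' (sub R ((Finset.univ.erase a : Finset α) : Set α)) ⊆ Pyr R a := by
    rintro _ ⟨z, hz, rfl⟩
    exact mem_pyr_iff.2 (hv.mul_left_of_forall_count_pos hcount (mem_sub_erase.1 hz))
  have hle := growthSeries_mono ht hsubset (growthSummable_pyr a ht h)
  rw [growthSeries_image_mul_right] at hle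
  calc t ^ len v = (mobius R (Finset.univ.erase a)).eval t * (t ^ len v *
        growthSeries (R := R) (sub R ((Finset.univ.erase a : Finset α) : Set α)) t) := by
        linear_combination (-t ^ len v) * eval_mobius_mul_growthSeries ht h
    _ ≤ (mobius R (Finset.univ.erase a)).eval t * growthSeries (Pyr R a) t :=
        mul_le_mul_of_nonneg_left hle (eval_mobius_pos ht h).le
    _ = _ := eval_mobius_mul_growthSeries_pyr a ht h

theorem pRoot_univ_lt (hR : (SimpleGraph.fromRel R).Connected) (a : α) :
    pRoot R Finset.univ < pRoot R (Finset.univ.erase a) := by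
  by_contra! hle
  have htop : pRoot R (Finset.univ.erase a) < ⊤ :=
    hle.trans_lt (pRoot_lt_top ⟨a, Finset.mem_univ a⟩)
  obtain ⟨v, hv, hcount⟩ := exists_isPyramid_forall_count_pos hR a
  have hlim := eval_le_eval_of_forall_lt_pRoot (continuous_pow (len v))
    (mobius R (Finset.univ.erase a)).continuous (fun t ht h => ?_) htop
  · rw [eval_mobius_pRoot htop] at hlim
    exact hlim.not_gt (pow_pos (ENNReal.toReal_pos (pRoot_pos _).ne' htop.ne) _)
  · linarith [pow_len_le_sub_eval_mobius hv hcount ht h, eval_mobius_pos ht (h.trans_le hle)]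

end Pyr

theorem growthSeries_pyr_toReal_pRoot [Fintype α] [Std.Refl R] [Std.Symm R]
    (hR : (SimpleGraph.fromRel R).Connected) (a : α) :
    growthSeries (Pyr R a) (pRoot R Finset.univ).toReal = 1 := by
  classical
  have htop : pRoot R Finset.univ < ⊤ := pRoot_lt_top ⟨a, Finset.mem_univ a⟩
  have hlt := pRoot_univ_lt hR a
  rw [← ENNReal.ofReal_toReal htop.ne] at hlt
  have hpyr := eval_mobius_mul_growthSeries_pyr a ENNReal.toReal_nonneg hlt
  rw [eval_mobius_pRoot htop, sub_zero] at hpyr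
  exact mul_left_cancel₀ (eval_mobius_pos ENNReal.toReal_nonneg hlt).ne'
    (hpyr.trans (mul_one _).symm)

theorem growthSeries_pyr_pRoot [Fintype α] [Std.Refl R] [Std.Symm R]
    (hR : (SimpleGraph.fromRel R).Connected) (a : α) :
    growthSeries (Pyr R a) (pRoot R Finset.univ) = 1 := by
  classical
  have hofReal := ENNReal.ofReal_toReal
    (pRoot_lt_top (R := R) (S := Finset.univ) ⟨a, Finset.mem_univ a⟩).ne
  rw [← hofReal, ← ofReal_growthSeries ENNReal.toReal_nonneg
      (growthSummable_pyr a ENNReal.toReal_nonneg (hofReal.trans_lt (pRoot_univ_lt hR a))),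
    growthSeries_pyr_toReal_pRoot hR, ENNReal.ofReal_one]

/-! ### Visual cylinders -/

instance : DiscreteMeasurableSpace (TraceMonoid R) := ⟨fun _ => trivial⟩

instance [Finite α] : Countable (TraceMonoid R) := word_surjective.countable

theorem NDSeq.seq_dvd_seq (s : NDSeq R) {m n : ℕ} (h : m ≤ n) : s.seq m ∣ s.seq n := by
  induction n, h using Nat.le_induction with
  | base => exact dvd_rfl
  | succ n _ ih => exact ih.trans (s.mono n)

theorem exists_lim_eq (ξ : Boundary R) : ∃ s : NDSeq R, GenTrace.lim s = ξ.1 := by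
  obtain ⟨⟨s⟩, -⟩ := ξ
  exact ⟨s, rfl⟩

theorem mem_cylinder_iff {x : TraceMonoid R} {ξ : Boundary R} {s : NDSeq R}
    (hs : GenTrace.lim s = ξ.1) : ξ ∈ cylinder x ↔ ∃ k, x ∣ s.seq k := by
  rw [cylinder, Set.mem_ofPred_eq, ← hs]
  exact ⟨fun h => h 0, fun h _ => h⟩

theorem mem_cylinder_inter_iff {x y : TraceMonoid R} {ξ : Boundary R} {s : NDSeq R}
    (hs : GenTrace.lim s = ξ.1) :
    ξ ∈ cylinder x ∩ cylinder y ↔ ∃ k, x ∣ s.seq k ∧ y ∣ s.seq k := by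
  rw [Set.mem_inter_iff, mem_cylinder_iff hs, mem_cylinder_iff hs]
  constructor
  · rintro ⟨⟨k, hk⟩, l, hl⟩
    exact ⟨max k l, hk.trans (s.seq_dvd_seq (le_max_left k l)),
      hl.trans (s.seq_dvd_seq (le_max_right k l))⟩
  · rintro ⟨k, hx, hy⟩
    exact ⟨⟨k, hx⟩, k, hy⟩

theorem cylinder_one : cylinder (1 : TraceMonoid R) = Set.univ := by
  ext ξ
  obtain ⟨s, hs⟩ := exists_lim_eq ξ
  simp [mem_cylinder_iff hs]

theorem measurableSet_cylinder (x : TraceMonoid R) : MeasurableSet (cylinder x) :=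
  MeasurableSpace.measurableSet_generateFrom ⟨x, rfl⟩

theorem cylinder_inter_cylinder {x y r : TraceMonoid R} (hr : ∀ m, y ∣ x * m ↔ r ∣ m) :
    cylinder x ∩ cylinder y = cylinder (x * r) := by
  ext ξ
  obtain ⟨s, hs⟩ := exists_lim_eq ξ
  rw [mem_cylinder_inter_iff hs, mem_cylinder_iff hs]
  refine exists_congr fun k => ⟨?_, fun h => ?_⟩
  · rintro ⟨⟨m, hm⟩, hy⟩
    rw [hm, hr] at hy
    exact hm ▸ mul_dvd_mul_left x hy
  · exact ⟨dvd_of_mul_right_dvd h, ((hr r).2 dvd_rfl).trans h⟩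

theorem disjoint_cylinder {x y : TraceMonoid R} (h : ∀ m, ¬ y ∣ x * m) :
    Disjoint (cylinder x) (cylinder y) := by
  rw [Set.disjoint_iff]
  intro ξ hξ
  obtain ⟨s, hs⟩ := exists_lim_eq ξ
  obtain ⟨k, ⟨m, hm⟩, hy⟩ := (mem_cylinder_inter_iff hs).1 hξ
  exact h m (hm ▸ hy)

theorem isPiSystem_cylinder [Std.Symm R] : IsPiSystem (Set.range (cylinder (R := R))) := by
  rintro _ ⟨x, rfl⟩ _ ⟨y, rfl⟩ hne
  obtain ⟨r, hr⟩ | hno := exists_dvd_mul_iff x y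
  · exact ⟨x * r, (cylinder_inter_cylinder hr).symm⟩
  · exact absurd (disjoint_cylinder hno) (Set.not_disjoint_iff_nonempty_inter.2 hne)

theorem IsUniformMeasure.unique [Fintype α] [Std.Symm R] {m m' : Measure (Boundary R)}
    (hm : IsUniformMeasure m) (hm' : IsUniformMeasure m') : m = m' := by
  have := hm.prob
  have := hm'.prob
  refine ext_of_generate_finite _ rfl isPiSystem_cylinder ?_ (by simp)
  rintro _ ⟨x, rfl⟩
  rw [hm.apply_cylinder, hm'.apply_cylinder]

theorem IsPyramid.disjoint_cylinder_mul [Std.Refl R] [Std.Symm R] {a : α} {v v' : TraceMonoid R}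
    (hv : IsPyramid a v) (hv' : IsPyramid a v') (hne : v ≠ v') (z : TraceMonoid R) :
    Disjoint (cylinder (z * v)) (cylinder (z * v')) := by
  refine disjoint_cylinder fun m hm => hne (hv.eq_of_dvd_of_dvd hv' (dvd_mul_right v m) ?_)
  obtain ⟨n, hn⟩ := hm
  exact ⟨n, mul_left_cancel (by rw [← mul_assoc, ← mul_assoc, hn] : z * (v * m) = z * (v' * n))⟩

/-! ### Infinite product measures -/

theorem eq_infinitePi_of_pi_range {X : ℕ → Type*} [∀ n, MeasurableSpace (X n)]
    {ν : ∀ n, Measure (X n)} [∀ n, IsProbabilityMeasure (ν n)] {μ : Measure (∀ n, X n)}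
    (h : ∀ n (t : ∀ i, Set (X i)), (∀ i, MeasurableSet (t i)) →
      μ (Set.pi (Finset.range n) t) = ∏ i ∈ Finset.range n, ν i (t i)) :
    μ = Measure.infinitePi ν := by
  classical
  refine Measure.eq_infinitePi _ fun s t ht => ?_
  obtain ⟨n, hn⟩ := s.exists_nat_subset_range
  let u (i : ℕ) : Set (X i) := if i ∈ s then t i else Set.univ
  have hu (i : ℕ) : MeasurableSet (u i) := by
    by_cases hi : i ∈ s <;> simp [u, hi, ht]
  have hpi : Set.pi (s : Set ℕ) t = Set.pi (Finset.range n) u := by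
    ext ω
    refine ⟨fun hω i _ => ?_, fun hω i hi => by simpa [u, Finset.mem_coe.1 hi] using hω i (hn hi)⟩
    by_cases hi : i ∈ s
    · simpa [u, hi] using hω i hi
    · simp [u, hi]
  rw [hpi, h n u hu, ← Finset.prod_subset hn fun i _ hi => by simp [u, hi]]
  exact Finset.prod_congr rfl fun i hi => by simp [u, hi]

/-- The sequence with a given first term and a given tail. -/
def seqCons {X : ℕ → Type*} (q : X 0 × ∀ n, X (n + 1)) : ∀ n, X n
  | 0 => q.1
  | n + 1 => q.2 n

theorem measurable_seqCons {X : ℕ → Type*} [∀ n, MeasurableSpace (X n)] :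
    Measurable (seqCons (X := X)) :=
  measurable_pi_iff.2 fun
    | 0 => measurable_fst
    | n + 1 => (measurable_pi_apply n).comp measurable_snd

theorem seqCons_preimage_pi_range_succ {X : ℕ → Type*} (t : ∀ n, Set (X n)) (n : ℕ) :
    seqCons ⁻¹' Set.pi (Finset.range (n + 1)) t =
      t 0 ×ˢ Set.pi (Finset.range n) fun i => t (i + 1) := by
  ext q
  simp only [Set.mem_preimage, Set.mem_pi, Finset.mem_coe, Finset.mem_range, Set.mem_prod,
    Nat.forall_lt_succ_left]
  rfl

theorem measurePreserving_seqCons {X : ℕ → Type*} [∀ n, MeasurableSpace (X n)]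
    (ν : ∀ n, Measure (X n)) [∀ n, IsProbabilityMeasure (ν n)] :
    MeasurePreserving seqCons ((ν 0).prod (Measure.infinitePi fun n => ν (n + 1)))
      (Measure.infinitePi ν) := by
  refine ⟨measurable_seqCons, eq_infinitePi_of_pi_range fun n t ht => ?_⟩
  rw [Measure.map_apply measurable_seqCons (.pi (Finset.countable_toSet _) fun i _ => ht i)]
  cases n with
  | zero => simp
  | succ n =>
    rw [seqCons_preimage_pi_range_succ, Measure.prod_prod,
      Measure.infinitePi_pi _ fun i _ => ht (i + 1), Finset.prod_range_succ', mul_comm]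

/-! ### Infinite products of pyramidal traces -/

/-- The products of the first terms of a sequence of traces. -/
def partialProd (ω : ℕ → TraceMonoid R) (n : ℕ) : TraceMonoid R := ((List.range n).map ω).prod

theorem partialProd_succ (ω : ℕ → TraceMonoid R) (n : ℕ) :
    partialProd ω (n + 1) = partialProd ω n * ω n :=
  List.prod_range_succ ω n

theorem partialProd_succ' (ω : ℕ → TraceMonoid R) (n : ℕ) :
    partialProd ω (n + 1) = ω 0 * partialProd (fun k => ω (k + 1)) n :=
  List.prod_range_succ' ω n

theorem count_partialProd {a : α} {ω : ℕ → TraceMonoid R} (h : ∀ n, count a (ω n) = 1) (n : ℕ) :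
    count a (partialProd ω n) = n := by
  induction n with
  | zero => exact count_one a
  | succ n ih => rw [partialProd_succ, count_mul, ih, h]

/-- The non-decreasing sequence of the partial products. -/
def prodSeq (ω : ℕ → TraceMonoid R) : NDSeq R :=
  ⟨partialProd ω, fun n => ⟨ω n, partialProd_succ ω n⟩⟩

theorem lim_prodSeq_notMem_range {a : α} {ω : ℕ → TraceMonoid R} (h : ∀ n, count a (ω n) = 1) :
    GenTrace.lim (prodSeq ω) ∉ Set.range (GenTrace.ofTrace (R := R)) := by
  rintro ⟨x, hx⟩
  have hle : prodSeq ω ≤ ⟨fun _ => x, fun _ => dvd_rfl⟩ := hx.ge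
  obtain ⟨-, y, hy : x = partialProd ω (count a x + 1) * y⟩ := hle (count a x + 1)
  have hcount := congrArg (count a) hy
  rw [count_mul, count_partialProd h] at hcount
  omega

theorem measurable_partialProd [Finite α] {A : Set (TraceMonoid R)} (n : ℕ) :
    Measurable fun ω : ℕ → A => partialProd (fun n => (ω n : TraceMonoid R)) n := by
  induction n with
  | zero => exact measurable_const
  | succ n ih =>
    have hmul : Measurable fun q : TraceMonoid R × TraceMonoid R => q.1 * q.2 :=
      Measurable.of_discrete
    simp only [partialProd_succ]
    exact hmul.comp (ih.prodMk (measurable_subtype_coe.comp (measurable_pi_apply n)))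

section InfProd

variable [Std.Refl R] [Std.Symm R] {a : α}

theorem count_eq_one_of_mem_pyr (v : Pyr R a) : count a (v : TraceMonoid R) = 1 :=
  (mem_pyr_iff.1 v.2).count_eq_one

/-- The infinite product of a sequence of pyramidal traces. -/
def infProd (ω : ℕ → Pyr R a) : Boundary R :=
  ⟨GenTrace.lim (prodSeq fun n => ω n), lim_prodSeq_notMem_range fun n =>
    count_eq_one_of_mem_pyr (ω n)⟩

theorem infProd_mem_cylinder_iff {ω : ℕ → Pyr R a} {x : TraceMonoid R} :
    infProd ω ∈ cylinder x ↔ ∃ n, x ∣ partialProd (fun n => (ω n : TraceMonoid R)) n :=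
  mem_cylinder_iff (s := prodSeq fun n => (ω n : TraceMonoid R)) rfl

theorem measurable_infProd [Finite α] : Measurable (infProd (R := R) (a := a)) := by
  refine measurable_generateFrom ?_
  rintro _ ⟨x, rfl⟩
  have hpre : infProd ⁻¹' cylinder x =
      ⋃ n, (fun ω : ℕ → Pyr R a => partialProd (fun n => (ω n : TraceMonoid R)) n) ⁻¹'
        {y | x ∣ y} := by
    ext ω
    simp [infProd_mem_cylinder_iff]
  rw [hpre]
  exact MeasurableSet.iUnion fun n => measurable_partialProd n .of_discrete

theorem infProd_mem_iUnion_cylinder_mul {ω : ℕ → Pyr R a} {z : TraceMonoid R}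
    (hω : infProd ω ∈ cylinder z) :
    ∃ v : Pyr R a, infProd ω ∈ cylinder (z * (v : TraceMonoid R)) := by
  simp only [infProd_mem_cylinder_iff] at hω ⊢
  obtain ⟨n, hn⟩ := hω
  obtain ⟨y, hy⟩ : z ∣ partialProd (fun n => (ω n : TraceMonoid R)) (n + count a z + 1) :=
    hn.trans ((prodSeq fun n => (ω n : TraceMonoid R)).seq_dvd_seq (by omega))
  have hcount := congrArg (count a) hy
  rw [count_partialProd fun n => count_eq_one_of_mem_pyr (ω n), count_mul] at hcount
  obtain ⟨v, hv, x, rfl⟩ := exists_isPyramid_dvd (show 0 < count a y by omega)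
  exact ⟨⟨v, mem_pyr_iff.2 hv⟩, _, x, by rw [hy, mul_assoc]⟩

theorem seqCons_preimage_infProd_preimage_cylinder (u : Pyr R a) (x : TraceMonoid R) :
    seqCons (X := fun _ => Pyr R a) ⁻¹' (infProd ⁻¹' cylinder ((u : TraceMonoid R) * x)) =
      {u} ×ˢ (infProd ⁻¹' cylinder x) := by
  ext ⟨v, ω⟩
  simp only [Set.mem_preimage, Set.mem_prod, Set.mem_singleton_iff, infProd_mem_cylinder_iff]
  have partialProd_cons (n : ℕ) :
      partialProd (fun n => (seqCons (X := fun _ => Pyr R a) (v, ω) n : TraceMonoid R)) (n + 1) =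
        v * partialProd (fun n => (ω n : TraceMonoid R)) n := partialProd_succ' _ n
  constructor
  · rintro ⟨n, hn⟩
    have hdvd := hn.trans (Dvd.intro _ (partialProd_succ _ n).symm)
    rw [partialProd_cons] at hdvd
    obtain rfl : v = u := Subtype.ext <| (mem_pyr_iff.1 v.2).eq_of_dvd_of_dvd (mem_pyr_iff.1 u.2)
      (dvd_mul_right _ _) (dvd_of_mul_right_dvd hdvd)
    obtain ⟨y, hy⟩ := hdvd
    exact ⟨rfl, n, y, mul_left_cancel (hy.trans (mul_assoc _ _ _))⟩
  · rintro ⟨rfl, n, hn⟩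
    exact ⟨n + 1, partialProd_cons n ▸ mul_dvd_mul_left _ hn⟩

end InfProd

/-! ### Existence of the uniform measure at infinity -/

theorem eq_of_tsum_eq_of_forall_eq_or_eq {ι : Type*} {w g : ι → ℝ≥0∞} {x y : ℝ≥0∞}
    (hw : ∑' i, w i = 1) (hg : ∀ i, g i = w i * x ∨ g i = w i * y) {i : ι} (hi : w i ≠ 0)
    (hgi : g i = w i * y) (hsum : ∑' i, g i = x) (hx : x ≠ ⊤) : x = y := by
  have hi_top : w i ≠ ⊤ := ENNReal.ne_top_of_tsum_ne_top (hw ▸ ENNReal.one_ne_top) i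
  have hwx : ∑' i, w i * x = x := by rw [ENNReal.tsum_mul_right, hw, one_mul]
  by_contra hne
  obtain hlt | hlt := lt_or_gt_of_ne hne
  · refine (ENNReal.tsum_lt_tsum (hwx.trans_ne hx) (fun j => ?_)
      (hgi ▸ ENNReal.mul_lt_mul_right hi hi_top hlt)).ne (hwx.trans hsum.symm)
    obtain hj | hj := hg j
    · exact hj.ge
    · exact hj ▸ by gcongr
  · refine (ENNReal.tsum_lt_tsum (hsum.trans_ne hx) (fun j => ?_)
      (hgi ▸ ENNReal.mul_lt_mul_right hi hi_top hlt)).ne (hsum.trans hwx.symm)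
    obtain hj | hj := hg j
    · exact hj.le
    · exact hj ▸ by gcongr

section ProdLaw

variable [Fintype α] [Std.Refl R] [Std.Symm R] (hR : (SimpleGraph.fromRel R).Connected) (a : α)

/-- The distribution on the pyramidal traces that gives the mass `p_Σ ^ |v|` to each `v`. -/
def pyrPMF : PMF (Pyr R a) :=
  ⟨fun v => pRoot R Finset.univ ^ len (v : TraceMonoid R),
    growthSeries_pyr_pRoot hR a ▸ ENNReal.summable.hasSum⟩

/-- The law of the infinite product of independent random pyramidal traces. -/
def prodLaw : Measure (Boundary R) :=
  (Measure.infinitePi fun _ : ℕ => (pyrPMF hR a).toMeasure).map infProd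

instance : IsProbabilityMeasure (prodLaw hR a) :=
  Measure.isProbabilityMeasure_map measurable_infProd.aemeasurable

theorem prodLaw_apply_cylinder (x : TraceMonoid R) : prodLaw hR a (cylinder x) =
    Measure.infinitePi (fun _ : ℕ => (pyrPMF hR a).toMeasure) (infProd ⁻¹' cylinder x) :=
  Measure.map_apply measurable_infProd (measurableSet_cylinder x)

theorem prodLaw_cylinder_mul {u : TraceMonoid R} (hu : IsPyramid a u) (x : TraceMonoid R) :
    prodLaw hR a (cylinder (u * x)) =
      pRoot R Finset.univ ^ len u * prodLaw hR a (cylinder x) := by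
  lift u to Pyr R a using mem_pyr_iff.2 hu
  rw [prodLaw_apply_cylinder, prodLaw_apply_cylinder,
    ← (measurePreserving_seqCons fun _ => (pyrPMF hR a).toMeasure).measure_preimage
      (measurable_infProd (measurableSet_cylinder _)).nullMeasurableSet,
    seqCons_preimage_infProd_preimage_cylinder, Measure.prod_prod,
    PMF.toMeasure_apply_singleton _ _ (measurableSet_singleton u)]
  rfl

theorem prodLaw_cylinder_of_isPyramid {v : TraceMonoid R} (hv : IsPyramid a v) :
    prodLaw hR a (cylinder v) = pRoot R Finset.univ ^ len v := by
  simpa [cylinder_one] using prodLaw_cylinder_mul hR a hv 1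

theorem tsum_prodLaw_cylinder_mul (z : TraceMonoid R) :
    ∑' v : Pyr R a, prodLaw hR a (cylinder (z * v)) = prodLaw hR a (cylinder z) := by
  have hpre : infProd (a := a) ⁻¹' cylinder z =
      ⋃ v : Pyr R a, infProd ⁻¹' cylinder (z * (v : TraceMonoid R)) := by
    ext ω
    simp only [Set.mem_iUnion, Set.mem_preimage]
    refine ⟨infProd_mem_iUnion_cylinder_mul, ?_⟩
    rintro ⟨v, hv⟩
    rw [infProd_mem_cylinder_iff] at hv ⊢
    exact hv.imp fun n => dvd_of_mul_right_dvd
  simp only [prodLaw_apply_cylinder]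
  rw [hpre, measure_iUnion]
  · intro v v' hne
    exact ((mem_pyr_iff.1 v.2).disjoint_cylinder_mul (mem_pyr_iff.1 v'.2)
      (Subtype.coe_injective.ne hne) z).preimage _
  · exact fun v => measurable_infProd (measurableSet_cylinder _)

variable {a}

theorem prodLaw_cylinder_mul_eq_or_eq {z v : TraceMonoid R} (hv : IsPyramid a v)
    (hz : count a z = 0)
    (ih : ∀ z', len z' < len z → count a z' = 0 →
      prodLaw hR a (cylinder z') = pRoot R Finset.univ ^ len z') :
    prodLaw hR a (cylinder (z * v)) =
        pRoot R Finset.univ ^ len v * prodLaw hR a (cylinder z) ∨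
      prodLaw hR a (cylinder (z * v)) =
        pRoot R Finset.univ ^ len v * pRoot R Finset.univ ^ len z := by
  obtain ⟨y, z', rfl, hyv, hcomm⟩ := hv.exists_split hz
  rw [mul_assoc, hcomm.eq, ← mul_assoc, prodLaw_cylinder_mul hR a hyv]
  by_cases hy : y = 1
  · simp [hy]
  · have hlen : 0 < len y := Nat.pos_of_ne_zero (mt len_eq_zero.1 hy)
    rw [count_mul, Nat.add_eq_zero_iff] at hz
    rw [ih z' (by simpa using hlen) hz.2, len_mul, len_mul]
    exact .inr (by ring)

theorem prodLaw_cylinder_of_count_eq_zero (z : TraceMonoid R) (hz : count a z = 0) :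
    prodLaw hR a (cylinder z) = pRoot R Finset.univ ^ len z := by
  induction hn : len z using Nat.strong_induction_on generalizing z with
  | _ n ih =>
    subst hn
    obtain ⟨v, hv, hcount⟩ := exists_isPyramid_forall_count_pos hR a
    refine eq_of_tsum_eq_of_forall_eq_or_eq (growthSeries_pyr_pRoot hR a)
      (fun u => prodLaw_cylinder_mul_eq_or_eq hR (mem_pyr_iff.1 u.2) hz
        fun z' hlt hz' => ih _ hlt z' hz' rfl)
      (i := ⟨v, mem_pyr_iff.2 hv⟩) (pow_ne_zero _ (pRoot_pos _).ne') ?_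
      (tsum_prodLaw_cylinder_mul hR a z) (measure_ne_top _ _)
    rw [prodLaw_cylinder_of_isPyramid hR a (hv.mul_left_of_forall_count_pos hcount hz), len_mul,
      pow_add, mul_comm]

variable (a)

theorem prodLaw_cylinder (x : TraceMonoid R) :
    prodLaw hR a (cylinder x) = pRoot R Finset.univ ^ len x := by
  induction hn : count a x generalizing x with
  | zero => exact prodLaw_cylinder_of_count_eq_zero hR x hn
  | succ n ih =>
    obtain ⟨v, hv, y, rfl⟩ := exists_isPyramid_dvd (show 0 < count a x by omega)
    rw [count_mul, hv.count_eq_one] at hn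
    rw [prodLaw_cylinder_mul hR a hv, ih y (by omega), len_mul, pow_add]

theorem isUniformMeasure_prodLaw : IsUniformMeasure (prodLaw hR a) :=
  ⟨inferInstance, prodLaw_cylinder hR a⟩

end ProdLaw

/-! ### The first pyramid of an infinite trace -/

section VInf

variable [Std.Refl R] [Std.Symm R] {a : α} {ξ : Boundary R} {v v' : TraceMonoid R}

theorem isVInf_iff : IsVInf a ξ v ↔ IsPyramid a v ∧ ξ ∈ cylinder v := by
  constructor
  · rintro ⟨s, hs, q, hq⟩
    obtain ⟨hv, hvq⟩ := isV_iff.1 (hq q le_rfl)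
    exact ⟨hv, (mem_cylinder_iff hs).2 ⟨q, hvq⟩⟩
  · rintro ⟨hv, hξ⟩
    obtain ⟨s, hs⟩ := exists_lim_eq ξ
    obtain ⟨k, hk⟩ := (mem_cylinder_iff hs).1 hξ
    exact ⟨s, hs, k, fun n hn => isV_iff.2 ⟨hv, hk.trans (s.seq_dvd_seq hn)⟩⟩

theorem IsVInf.unique (h : IsVInf a ξ v) (h' : IsVInf a ξ v') : v = v' := by
  rw [isVInf_iff] at h h'
  by_contra hne
  have hdisj := h.1.disjoint_cylinder_mul h'.1 hne 1
  rw [one_mul, one_mul] at hdisj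
  exact hdisj.notMem_of_mem_left h.2 h'.2

theorem vInf_eq_iff (hv : IsPyramid a v) : VInf a ξ = v ↔ ξ ∈ cylinder v := by
  have hne : (1 : TraceMonoid R) ≠ v := fun h => by simpa [← h] using hv.len_pos
  have isVInf_iff_mem : IsVInf a ξ v ↔ ξ ∈ cylinder v := isVInf_iff.trans (and_iff_right hv)
  rw [← isVInf_iff_mem, VInf]
  split_ifs with h
  · exact ⟨fun hchoose => hchoose ▸ h.choose_spec, h.choose_spec.unique⟩
  · exact iff_of_false hne fun hξ => h ⟨v, hξ⟩

theorem vInf_eq_one (h : ¬ IsPyramid a (VInf a ξ)) : VInf a ξ = 1 := by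
  refine dif_neg ?_
  rintro ⟨v, hv⟩
  rw [isVInf_iff] at hv
  exact h ((vInf_eq_iff hv.1).2 hv.2 ▸ hv.1)

theorem vInf_preimage_singleton_one : VInf a ⁻¹' {(1 : TraceMonoid R)} =
    (⋃ v ∈ {v : TraceMonoid R | IsPyramid a v}, cylinder v)ᶜ := by
  ext ξ
  simp only [Set.mem_preimage, Set.mem_singleton_iff, Set.mem_compl_iff, Set.mem_iUnion₂,
    Set.mem_ofPred_eq, not_exists]
  refine ⟨fun h v hv hξ => ?_, fun h => vInf_eq_one fun hv => h _ hv ((vInf_eq_iff hv).1 rfl)⟩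
  simpa [(vInf_eq_iff hv).2 hξ ▸ h] using hv.len_pos

theorem existsUnique_isVInf (h : VInf a ξ ∈ Pyr R a) : ∃! v, IsVInf a ξ v := by
  have hV := mem_pyr_iff.1 h
  have hVξ : IsVInf a ξ (VInf a ξ) := isVInf_iff.2 ⟨hV, (vInf_eq_iff hV).1 rfl⟩
  exact ⟨VInf a ξ, hVξ, fun v hv => hv.unique hVξ⟩

theorem measurable_vInf [Finite α] (a : α) : Measurable (VInf (R := R) a) := by
  refine measurable_to_countable fun ξ => ?_
  by_cases hv : IsPyramid a (VInf a ξ)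
  · convert measurableSet_cylinder (VInf a ξ)
    ext η
    exact vInf_eq_iff hv
  · rw [vInf_eq_one hv, vInf_preimage_singleton_one]
    exact (MeasurableSet.biUnion (Set.to_countable _) fun v _ => measurableSet_cylinder v).compl

theorem IsUniformMeasure.vInf_eq [Fintype α] {m : Measure (Boundary R)} (hm : IsUniformMeasure m)
    (hv : v ∈ Pyr R a) : m {ξ | VInf a ξ = v} = pRoot R Finset.univ ^ len v := by
  simp only [vInf_eq_iff (mem_pyr_iff.1 hv)]
  exact hm.apply_cylinder v

end VInf

/-! ### Laws of random pyramidal traces -/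

section Laws

instance (S : Set α) : DiscreteMeasurableSpace (sub R S) :=
  ⟨fun A => ⟨_, .of_discrete, Set.preimage_image_eq A Subtype.val_injective⟩⟩

theorem multMeasure_apply {S : Finset α} {t : ℝ} (hμ : 0 ≤ (mobius R S).eval t) (ht : 0 ≤ t)
    (A : Set (sub R (S : Set α))) :
    multMeasure R S t A = ENNReal.ofReal ((mobius R S).eval t) *
      growthSeries (Subtype.val '' A) (ENNReal.ofReal t) := by
  have hA : MeasurableSet A := .of_discrete
  rw [multMeasure, Measure.sum_apply _ hA, growthSeries,
    tsum_image (fun x => ENNReal.ofReal t ^ len x) Subtype.val_injective.injOn,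
    tsum_subtype A fun x : sub R (S : Set α) => ENNReal.ofReal t ^ len (x : TraceMonoid R),
    ← ENNReal.tsum_mul_left]
  refine tsum_congr fun x => ?_
  rw [Measure.smul_apply, Measure.dirac_apply' _ hA, smul_eq_mul, ENNReal.ofReal_mul hμ,
    ENNReal.ofReal_pow ht]
  by_cases hx : x ∈ A <;> simp [hx]

theorem isProbabilityMeasure_multMeasure [Std.Symm R] {S : Finset α} {t : ℝ} (ht : 0 ≤ t)
    (h : ENNReal.ofReal t < pRoot R S) : IsProbabilityMeasure (multMeasure R S t) := by
  have hμ := (eval_mobius_pos ht h).le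
  constructor
  rw [multMeasure_apply hμ ht, Set.image_univ, Subtype.range_coe,
    ← ofReal_growthSeries ht ((growthSummable_sub_iff ht).2 h), ← ENNReal.ofReal_mul hμ,
    eval_mobius_mul_growthSeries ht h, ENNReal.ofReal_one]

variable [Fintype α] [Std.Refl R] [Std.Symm R] {a : α}

section RandomPyr

variable {Ω Ω' : Type*} [MeasurableSpace Ω] [MeasurableSpace Ω'] {P : Measure Ω}
  [IsProbabilityMeasure P] {P' : Measure Ω'} [IsProbabilityMeasure P'] {X : Ω → TraceMonoid R}
  {X' : Ω' → TraceMonoid R}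

theorem ae_mem_pyr (hR : (SimpleGraph.fromRel R).Connected) (hX : AEMeasurable X P)
    (h : ∀ v ∈ Pyr R a, P {ω | X ω = v} = pRoot R Finset.univ ^ len v) :
    ∀ᵐ ω ∂P, X ω ∈ Pyr R a := by
  have : IsProbabilityMeasure (P.map X) := Measure.isProbabilityMeasure_map hX
  have hmass : P.map X (Pyr R a) = 1 := by
    rw [← Measure.tsum_indicator_apply_singleton _ _ .of_discrete,
      ← tsum_subtype (Pyr R a) fun v => P.map X {v}, ← growthSeries_pyr_pRoot hR a]
    refine tsum_congr fun v => ?_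
    rw [Measure.map_apply_of_aemeasurable hX (measurableSet_singleton _), ← h v v.2]
    rfl
  exact ae_of_ae_map hX ((prob_compl_eq_zero_iff .of_discrete).2 hmass)

theorem measure_eq_zero_of_notMem_pyr (hR : (SimpleGraph.fromRel R).Connected)
    (hX : AEMeasurable X P)
    (h : ∀ v ∈ Pyr R a, P {ω | X ω = v} = pRoot R Finset.univ ^ len v) {v : TraceMonoid R}
    (hv : v ∉ Pyr R a) : P {ω | X ω = v} = 0 :=
  measure_mono_null (fun ω (hω : X ω = v) => by simpa [hω] using hv) (ae_mem_pyr hR hX h)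

theorem identDistrib_of_forall_mem_pyr (hR : (SimpleGraph.fromRel R).Connected)
    (hX : AEMeasurable X P) (hX' : AEMeasurable X' P')
    (h : ∀ v ∈ Pyr R a, P {ω | X ω = v} = pRoot R Finset.univ ^ len v)
    (h' : ∀ v ∈ Pyr R a, P' {ω | X' ω = v} = pRoot R Finset.univ ^ len v) :
    IdentDistrib X X' P P' := by
  refine ⟨hX, hX', Measure.ext_of_singleton fun v => ?_⟩
  rw [Measure.map_apply_of_aemeasurable hX (measurableSet_singleton v),
    Measure.map_apply_of_aemeasurable hX' (measurableSet_singleton v)]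
  change P {ω | X ω = v} = P' {ω | X' ω = v}
  by_cases hv : v ∈ Pyr R a
  · rw [h v hv, h' v hv]
  · rw [measure_eq_zero_of_notMem_pyr hR hX h hv, measure_eq_zero_of_notMem_pyr hR hX' h' hv]

end RandomPyr

variable [DecidableEq α]

theorem ofReal_toReal_pRoot_univ_lt (hR : (SimpleGraph.fromRel R).Connected) (a : α) :
    ENNReal.ofReal (pRoot R Finset.univ).toReal < pRoot R (Finset.univ.erase a) :=
  ENNReal.ofReal_toReal_le.trans_lt (pRoot_univ_lt hR a)

theorem pRoot_mul_multMeasure_maxIn (hR : (SimpleGraph.fromRel R).Connected) (a : α) :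
    pRoot R Finset.univ * multMeasure R (Finset.univ.erase a) (pRoot R Finset.univ).toReal
      {z | MaxIn (link R a) (z : TraceMonoid R)} =
    ENNReal.ofReal ((mobius R (Finset.univ.erase a)).eval (pRoot R Finset.univ).toReal) := by
  have hp : ENNReal.ofReal (pRoot R Finset.univ).toReal = pRoot R Finset.univ :=
    ENNReal.ofReal_toReal (pRoot_lt_top ⟨a, Finset.mem_univ a⟩).ne
  have hlt := ofReal_toReal_pRoot_univ_lt hR a
  set t := (pRoot R Finset.univ).toReal
  have ht : 0 ≤ t := ENNReal.toReal_nonneg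
  have hval : Subtype.val '' {z : sub R ((Finset.univ.erase a : Finset α) : Set α) |
      MaxIn (link R a) (z : TraceMonoid R)} = {z | count a z = 0 ∧ MaxIn (link R a) z} := by
    ext z
    simp [← mem_sub_erase, and_comm]
  have hsum : GrowthSummable {z : TraceMonoid R | count a z = 0 ∧ MaxIn (link R a) z} t :=
    ((growthSummable_sub_iff ht).2 hlt).mono fun z hz => mem_sub_erase.2 hz.1
  have hpyr := growthSeries_pyr_toReal_pRoot hR a
  rw [pyr_eq_image, growthSeries_image_mul_right, len_letter, pow_one] at hpyr
  rw [multMeasure_apply (eval_mobius_pos ht hlt).le ht, hval, ← ofReal_growthSeries ht hsum,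
    mul_left_comm, ← hp, ← ENNReal.ofReal_mul ht, hpyr, ENNReal.ofReal_one, mul_one]

theorem multMeasure_maxIn_ne_zero (hR : (SimpleGraph.fromRel R).Connected) (a : α) :
    multMeasure R (Finset.univ.erase a) (pRoot R Finset.univ).toReal
      {z | MaxIn (link R a) (z : TraceMonoid R)} ≠ 0 := by
  have hμ := eval_mobius_pos ENNReal.toReal_nonneg (ofReal_toReal_pRoot_univ_lt hR a)
  rw [← ENNReal.ofReal_pos, ← pRoot_mul_multMeasure_maxIn hR a] at hμ
  exact right_ne_zero_of_mul hμ.ne'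

theorem cond_multMeasure_mul_letter_eq (hR : (SimpleGraph.fromRel R).Connected)
    {v : TraceMonoid R} (hv : v ∈ Pyr R a) :
    ((multMeasure R (Finset.univ.erase a) (pRoot R Finset.univ).toReal)[|
      {z | MaxIn (link R a) (z : TraceMonoid R)}])
        {z | (z : TraceMonoid R) * letter R a = v} = pRoot R Finset.univ ^ len v := by
  have hp : ENNReal.ofReal (pRoot R Finset.univ).toReal = pRoot R Finset.univ :=
    ENNReal.ofReal_toReal (pRoot_lt_top ⟨a, Finset.mem_univ a⟩).ne
  have hlt := ofReal_toReal_pRoot_univ_lt hR a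
  have := isProbabilityMeasure_multMeasure ENNReal.toReal_nonneg hlt
  rw [pyr_eq_image] at hv
  obtain ⟨z, ⟨hz, hmax⟩, rfl⟩ := hv
  lift z to sub R ((Finset.univ.erase a : Finset α) : Set α) using mem_sub_erase.2 hz
  have hinter : {y : sub R ((Finset.univ.erase a : Finset α) : Set α) |
      MaxIn (link R a) (y : TraceMonoid R)} ∩
      {y | (y : TraceMonoid R) * letter R a = z * letter R a} = {z} := by
    ext y
    simp only [Set.mem_inter_iff, Set.mem_ofPred_eq, mul_left_inj, SetLike.coe_eq_coe,
      Set.mem_singleton_iff, and_iff_right_iff_imp]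
    rintro rfl
    exact hmax
  have hz_mass : multMeasure R (Finset.univ.erase a) (pRoot R Finset.univ).toReal {z} =
      ENNReal.ofReal ((mobius R (Finset.univ.erase a)).eval (pRoot R Finset.univ).toReal) *
        pRoot R Finset.univ ^ len (z : TraceMonoid R) := by
    rw [multMeasure_apply (eval_mobius_pos ENNReal.toReal_nonneg hlt).le ENNReal.toReal_nonneg,
      Set.image_singleton, growthSeries_singleton, hp]
  rw [cond_apply .of_discrete, hinter, hz_mass, ← pRoot_mul_multMeasure_maxIn hR a]
  simp only [len_mul, len_letter, pow_succ']
  rw [mul_right_comm, mul_comm, mul_assoc,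
    ENNReal.mul_inv_cancel (multMeasure_maxIn_ne_zero hR a) (measure_ne_top _ _), mul_one]

end Laws

end TraceMonoid

end

open TraceMonoid in
theorem mainTheorem5 {α : Type*} [Fintype α] [DecidableEq α] (R : α → α → Prop)
    (hrefl : ∀ a, R a a) (hsymm : ∀ a b, R a b → R b a)
    (hirr : (SimpleGraph.fromRel R).Connected) (a₁ : α) :
    -- `0 < p_Σ < p_{Σ∖{a₁}}`
    0 < pRoot R Finset.univ ∧
    pRoot R Finset.univ < pRoot R (Finset.univ.erase a₁) ∧
    -- `B_{Σ∖{a₁}, p_Σ}` is a probability distribution, and the conditioning event is not null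
    IsProbabilityMeasure
      (multMeasure R (Finset.univ.erase a₁) (pRoot R Finset.univ).toReal) ∧
    multMeasure R (Finset.univ.erase a₁) (pRoot R Finset.univ).toReal
      {z | MaxIn (link R a₁) (z : TraceMonoid R)} ≠ 0 ∧
    -- the uniform measure at infinity exists and is unique
    (∃! m : Measure (Boundary R), IsUniformMeasure m) ∧
    ∀ m : Measure (Boundary R), IsUniformMeasure m →
      -- `V_{a₁}` is almost surely defined, with law `p_Σ^|v|` on the pyramidal traces
      (∀ᵐ ξ ∂m, ∃! v, IsVInf a₁ ξ v) ∧
      (∀ v ∈ Pyr R a₁, m {ξ | VInf a₁ ξ = v} = pRoot R Finset.univ ^ len v) ∧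
      -- the output `Z · a₁` of the algorithm, for every output `Z` of `𝒜` with the required law
      ∀ {Ω : Type*} [MeasurableSpace Ω] (P : Measure Ω) [IsProbabilityMeasure P]
        (Z : Ω → sub R ((Finset.univ.erase a₁ : Finset α) : Set α)),
        HasLaw Z
          ((multMeasure R (Finset.univ.erase a₁) (pRoot R Finset.univ).toReal)[|
            {z | MaxIn (link R a₁) (z : TraceMonoid R)}]) P →
        (∀ᵐ ω ∂P, (Z ω : TraceMonoid R) * letter R a₁ ∈ Pyr R a₁) ∧
        (∀ v ∈ Pyr R a₁,
          P {ω | (Z ω : TraceMonoid R) * letter R a₁ = v} = pRoot R Finset.univ ^ len v) ∧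
        IdentDistrib (fun ω => (Z ω : TraceMonoid R) * letter R a₁) (VInf a₁) P m := by
  have : Std.Refl R := ⟨hrefl⟩
  have : Std.Symm R := ⟨hsymm⟩
  refine ⟨pRoot_pos _, pRoot_univ_lt hirr a₁, isProbabilityMeasure_multMeasure
    ENNReal.toReal_nonneg (ofReal_toReal_pRoot_univ_lt hirr a₁), multMeasure_maxIn_ne_zero hirr a₁,
    ⟨prodLaw hirr a₁, isUniformMeasure_prodLaw hirr a₁,
      fun m hm => hm.unique (isUniformMeasure_prodLaw hirr a₁)⟩, fun m hm => ?_⟩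
  have := hm.prob
  have hV : AEMeasurable (VInf (R := R) a₁) m := (measurable_vInf a₁).aemeasurable
  have hVlaw : ∀ v ∈ Pyr R a₁, m {ξ | VInf a₁ ξ = v} = pRoot R Finset.univ ^ len v :=
    fun v hv => hm.vInf_eq hv
  refine ⟨(ae_mem_pyr hirr hV hVlaw).mono fun ξ => existsUnique_isVInf, hVlaw,
    fun {Ω} _ P _ Z hZ => ?_⟩
  have hZa : AEMeasurable (fun ω => (Z ω : TraceMonoid R) * letter R a₁) P :=
    Measurable.of_discrete (f := fun z : sub R _ => (z : TraceMonoid R) * letter R a₁)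
      |>.comp_aemeasurable hZ.aemeasurable
  have hZlaw : ∀ v ∈ Pyr R a₁, P {ω | (Z ω : TraceMonoid R) * letter R a₁ = v} =
      pRoot R Finset.univ ^ len v := fun v hv =>
    (hZ.measure_eq (p := fun z => (z : TraceMonoid R) * letter R a₁ = v) .of_discrete).trans
      (cond_multMeasure_mul_letter_eq hirr hv)
  exact ⟨ae_mem_pyr hirr hZa hZlaw, hZlaw, identDistrib_of_forall_mem_pyr hirr hZa hV hZlaw hVlaw⟩
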